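/- Let $\mathbf P\subset\mathbb R^3_{\ge}$ be a convex polyhedron, i.e. the convex hull of finitely many points, not all coplanar, and let $C=L_{\mathbb R_\ge}(\mathbf P)$ be the cone of all finite nonnegative combinations of points of $\mathbf P$. The topological interior $\mathrm{T\text{-}int}$ and the boundary $\partial$ below are those of the subspace $C$ of $\mathbb R^3$. Put $\mathbb L_k=\mathrm H(k\mathbf P\cup(k+1)\mathbf P)\setminus(k\mathbf P\cup(k+1)\mathbf P)$, where $\mathrm H$ is the convex hull, and let $\overline{\mathbb L}_k$ be its closure. Let $\mathcal V$ be the set of vertices of $\mathbf P$. For $P\in\mathcal V$ let $\tau_P$ be the ray from the origin through $P$, and let $P'$ be the point with $\tau_P\cap\mathbf P=\overline{PP'}$. Let $\mathcal W$ be the set of $P\in\mathcal V$ with $P=P'$. Let $\mathcal W_1$ (resp. $\mathcal W_2$) be the set of $P\in\mathcal V$ lying on an extremal ray of $C$ with $\|P\|<\|P'\|$ (resp. $\|P'\|<\|P\|$), and let $\mathcal V_1$ (resp. $\mathcal V_2$) be the set of $P\in\mathcal V$ on no extremal ray of $C$ with $\|P\|<\|P'\|$ (resp. $\|P'\|<\|P\|$).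 Two vertices of $\mathbf P$ are adjacent if they are joined by an edge of $\mathbf P$. For $P\in\mathcal W$ and $k\in\mathbb N$ let $$\mathbb G_P^k=\{kP,(k+1)P\}\cup\bigcup_{Q}\big((k+1)\overline{PQ}\cap k\,\partial\mathbf P\big)\cup\bigcup_{Q'}\big(k\overline{PQ'}\cap(k+1)\,\partial\mathbf P\big),$$ where $Q$ runs over the points of $\mathcal V_1\cup\mathcal W_1$ adjacent to $P$ and $Q'$ over the points of $\mathcal V_2\cup\mathcal W_2$ adjacent to $P$. Assume that some extremal ray of $C$ meets $\mathbf P$ in exactly one point, and that every edge of $\mathbf P$ whose two endpoints belong to $\mathcal W$ is contained in the boundary of $C$ in $\mathbb R^3$ (that is, its endpoints lie on two extremal rays belonging to a common face of $C$). Then there is a least $\kappa_0\in\mathbb N$ such that for every integer $k\ge\kappa_0$ one has $(k+1)Q\in\mathrm{T\text{-}int}(k\mathbf P)$ for all $Q\in\mathcal V_1\cup\mathcal W_1$ and $kQ'\in\mathrm{T\text{-}int}((k+1)\mathbf P)$ for all $Q'\in\mathcal V_2\cup\mathcal W_2$. For every integer $k\ge\kappa_0$, the set $\bigcup_{P\in\mathcal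 W}\mathbb G_P^k$ is the vertex set of $\overline{\mathbb L}_k$. Here a vertex of the (in general non-convex) polyhedral set $\overline{\mathbb L}_k$ is a point $x$ of it such that near $x$ the set is not invariant under translation along any nonzero direction. -/

import Mathlib

open scoped Pointwise

namespace PolyhedronCone

/-- Euclidean three-space. -/
abbrev E3 : Type := EuclideanSpace ℝ (Fin 3)

/-- A (solid, bounded) convex polyhedron: the convex hull of finitely many points, with nonempty
interior (equivalently, the points are not coplanar). -/
def IsConvexPolyhedron (P : Set E3) : Prop :=
  (∃ S : Finset E3, P = convexHull ℝ (S : Set E3)) ∧ (interior P).Nonempty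

/-- The cone generated by `A`: all finite sums `∑ qᵢ aᵢ` with `qᵢ ≥ 0` and `aᵢ ∈ A`. -/
def cone (A : Set E3) : Set E3 := (PointedCone.hull ℝ A : Set E3)

/-- The ray through `v` with origin at `0`. -/
def ray (v : E3) : Set E3 := {x | ∃ r : ℝ, 0 ≤ r ∧ x = r • v}

/-- The set of extremal rays of `cone A`. -/
def extremalRays (A : Set E3) : Set (Set E3) :=
  {τ | ∃ v : E3, v ≠ 0 ∧ τ = ray v ∧ IsExtreme ℝ (cone A) τ}

/-- The union of the extremal rays of `cone A`. -/
def extremalPoints (A : Set E3) : Set E3 := ⋃ τ ∈ extremalRays A, τ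

/-- Topological interior of `X` in the subspace `C`. -/
def relInterior (C X : Set E3) : Set E3 :=
  Subtype.val '' interior ((Subtype.val : C → E3) ⁻¹' X)

/-- Topological boundary of `X` in the subspace `C`. -/
def relBoundary (C X : Set E3) : Set E3 :=
  Subtype.val '' frontier ((Subtype.val : C → E3) ⁻¹' X)

/-- The vertices of a convex polyhedron. -/
def vertices (P : Set E3) : Set E3 := P.extremePoints ℝ

/-- Two distinct vertices are adjacent if the segment joining them is an edge, that is, a face. -/
def Adjacent (P : Set E3) (A B : E3) : Prop :=
  A ∈ vertices P ∧ B ∈ vertices P ∧ A ≠ B ∧ IsExtreme ℝ P (segment ℝ A B)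

/-- `A'` is the other end of the segment cut out of `P` by the ray through `A`. -/
def IsOtherEnd (P : Set E3) (A A' : E3) : Prop := ray A ∩ P = segment ℝ A A'

/-- Vertices whose ray meets `P` in this vertex only. -/
def W (P : Set E3) : Set E3 := {A | A ∈ vertices P ∧ IsOtherEnd P A A}

/-- Vertices on extremal rays that are the end nearer to the origin of a proper segment. -/
def W₁ (P : Set E3) : Set E3 :=
  {A | A ∈ vertices P ∧ A ∈ extremalPoints P ∧ ∃ A', IsOtherEnd P A A' ∧ ‖A‖ < ‖A'‖}

/-- Vertices on extremal rays that are the end farther from the origin of a proper segment. -/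
def W₂ (P : Set E3) : Set E3 :=
  {A | A ∈ vertices P ∧ A ∈ extremalPoints P ∧ ∃ A', IsOtherEnd P A A' ∧ ‖A'‖ < ‖A‖}

/-- Vertices off the extremal rays that are the nearer end of a proper segment. -/
def V₁ (P : Set E3) : Set E3 :=
  {A | A ∈ vertices P ∧ A ∉ extremalPoints P ∧ ∃ A', IsOtherEnd P A A' ∧ ‖A‖ < ‖A'‖}

/-- Vertices off the extremal rays that are the farther end of a proper segment. -/
def V₂ (P : Set E3) : Set E3 :=
  {A | A ∈ vertices P ∧ A ∉ extremalPoints P ∧ ∃ A', IsOtherEnd P A A' ∧ ‖A'‖ < ‖A‖}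

/-- `L_k = H(kP ∪ (k+1)P) \ (kP ∪ (k+1)P)`. -/
def L (P : Set E3) (k : ℕ) : Set E3 :=
  convexHull ℝ ((k : ℝ) • P ∪ ((k : ℝ) + 1) • P) \ ((k : ℝ) • P ∪ ((k : ℝ) + 1) • P)

/-- The thresholds `κ` such that for all `k ≥ κ`, every `(k+1)Q` with `Q ∈ V₁ ∪ W₁` is interior to
`kP` and every `kQ'` with `Q' ∈ V₂ ∪ W₂` is interior to `(k+1)P`, interiors being taken in the
cone generated by `P`. -/
def thresholds (P : Set E3) : Set ℕ :=
  {κ | ∀ k : ℕ, κ ≤ k →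
    (∀ Q ∈ V₁ P ∪ W₁ P, ((k : ℝ) + 1) • Q ∈ relInterior (cone P) ((k : ℝ) • P)) ∧
    (∀ Q ∈ V₂ P ∪ W₂ P, (k : ℝ) • Q ∈ relInterior (cone P) (((k : ℝ) + 1) • P))}

/-- The elements of `V₁ ∪ W₁` adjacent to `A`. -/
def nearNeighbours (P : Set E3) (A : E3) : Set E3 := {Q | Q ∈ V₁ P ∪ W₁ P ∧ Adjacent P A Q}

/-- The elements of `V₂ ∪ W₂` adjacent to `A`. -/
def farNeighbours (P : Set E3) (A : E3) : Set E3 := {Q | Q ∈ V₂ P ∪ W₂ P ∧ Adjacent P A Q}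

/-- The set `G_A^k`, boundaries being taken in the cone generated by `P`. -/
def G (P : Set E3) (k : ℕ) (A : E3) : Set E3 :=
  {(k : ℝ) • A, ((k : ℝ) + 1) • A} ∪
    (⋃ Q ∈ nearNeighbours P A,
      (((k : ℝ) + 1) • segment ℝ A Q) ∩ ((k : ℝ) • relBoundary (cone P) P)) ∪
    (⋃ Q ∈ farNeighbours P A,
      ((k : ℝ) • segment ℝ A Q) ∩ (((k : ℝ) + 1) • relBoundary (cone P) P))

/-- `X` agrees near `x` with its translates along the direction `w`. -/
def LocallyInvariantAlong (X : Set E3) (x w : E3) : Prop :=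
  ∃ ε > 0, ∀ y ∈ Metric.ball x ε, ∀ t : ℝ, y + t • w ∈ Metric.ball x ε →
    (y ∈ X ↔ y + t • w ∈ X)

/-- The vertex set of a (not necessarily convex) polyhedral set: the points of `X` near which `X`
is not invariant along any direction, that is, the faces of dimension zero. For a convex
polytope these are its extreme points. -/
def polyhedralVertices (X : Set E3) : Set E3 :=
  {x | x ∈ X ∧ ∀ w : E3, w ≠ 0 → ¬ LocallyInvariantAlong X x w}

end PolyhedronCone

/-! The hypothesis on an extremal ray gives `0 ∉ P`. Sorting the facet inequalities of `P` by the
sign of their constant term then gives three families of linear functionals (`RadialData`). Write F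
for the maximum of the far functionals `I` and Γ for the minimum of the near ones `J`. On the cone
C, cut out by `H`, one has F ≤ Γ; `P` is the part of C where F ≤ 1 ≤ Γ, and for t > 0 the dilate tP
is the part where F ≤ t ≤ Γ. Hence for k > 0 the set `L P k` is {F > k, Γ < k + 1} in C. A vertex is
in `W` when F = Γ = 1, near when F < 1, far when Γ > 1.

The first main point is that the closure is {F ≥ k, Γ ≤ k + 1} (`mem_closure_L`). This can only fail
where F = k and Γ = k + 1; there the active far and near functionals would be proportional along the
minimal face of C, which forces the vertices of the corresponding faces of `P` into `W`. The edge
hypothesis makes a near face with vertices in `W` fill its whole section of C (`mem_of_near_face`),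
so it would meet the ray of a far vertex in `W` at a second point.

The second point is local. Where both surfaces are slack, the radial direction is an invariance.
Where one is slack, vertices are dilates of vertices of `P`, and the threshold puts those in `W`.
Where both are tight, the near face through x/(k+1) and the far face through x/k have independent
directions in dimension three, so one of them is an edge. The threshold leaves it an end in `W`; the
edge hypothesis and a planar argument (`eq_or_eq_of_mem_W`) rule out that all edges so found have
both ends in `W`, so one of them ends in a near or far vertex, as in `G`. Conversely, at each point
of `G` an invariance direction is excluded by directions that leave the set. -/

namespace PolyhedronCone

/-! ### Finitely generated cones and polytopes as intersections of half-spaces -/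

/-- One step of Fourier-Motzkin elimination: adding a generator to a cone cut out by finitely many
linear inequalities gives a cone of the same kind. -/
theorem exists_finset_dual_add_generator {V : Type*} [AddCommGroup V] [Module ℝ V]
    (N : Finset (Module.Dual ℝ V)) (v : V) :
    ∃ N' : Finset (Module.Dual ℝ V), ∀ z : V,
      (∃ t : ℝ, 0 ≤ t ∧ ∀ l ∈ N, 0 ≤ l (z - t • v)) ↔ ∀ l ∈ N', 0 ≤ l z := by
  classical
  -- Constraints with `l v ≥ 0` survive as they are; each pair of opposite signs at `v` contributes
  -- the positive combination that vanishes at `v`.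
  refine ⟨N.filter (fun l => 0 ≤ l v) ∪
    ((N.filter (fun l => 0 < l v)) ×ˢ (N.filter (fun l => l v < 0))).image
      (fun q => q.1 v • q.2 - q.2 v • q.1), fun z => ⟨?_, ?_⟩⟩
  · rintro ⟨t, ht, h⟩ l hl
    simp only [map_sub, map_smul, smul_eq_mul] at h
    rcases Finset.mem_union.1 hl with hl | hl
    · obtain ⟨hl, hv⟩ := Finset.mem_filter.1 hl
      have := h l hl
      nlinarith [mul_nonneg ht hv]
    · obtain ⟨⟨p, n⟩, hq, rfl⟩ := Finset.mem_image.1 hl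
      simp only [Finset.mem_product, Finset.mem_filter] at hq
      obtain ⟨⟨hp, hpv⟩, hn, hnv⟩ := hq
      have h1 := mul_nonneg hpv.le (h n hn)
      have h2 := mul_nonneg (neg_pos.2 hnv).le (h p hp)
      simp only [LinearMap.sub_apply, LinearMap.smul_apply, smul_eq_mul]
      nlinarith
  · intro h
    -- The least admissible `t`: the maximum of 0 and of the lower bounds imposed by the constraints
    -- negative at `v`. The paired constraints say that it respects every upper bound.
    obtain ⟨t, htm, ht⟩ := Finset.exists_max_image
      (insert 0 ((N.filter (fun l => l v < 0)).image fun l => l z / l v)) id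
      (Finset.insert_nonempty _ _)
    have ht0 : 0 ≤ t := ht 0 (Finset.mem_insert_self _ _)
    refine ⟨t, ht0, fun l hl => ?_⟩
    simp only [map_sub, map_smul, smul_eq_mul]
    rcases lt_trichotomy (l v) 0 with hv | hv | hv
    · have := ht (l z / l v) (Finset.mem_insert_of_mem
        (Finset.mem_image_of_mem _ (Finset.mem_filter.2 ⟨hl, hv⟩)))
      simp only [id] at this
      rw [div_le_iff_of_neg hv] at this
      linarith
    · have := h l (Finset.mem_union_left _ (Finset.mem_filter.2 ⟨hl, hv.ge⟩))
      rw [hv]; linarith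
    · rcases Finset.mem_insert.1 htm with rfl | htm
      · have := h l (Finset.mem_union_left _ (Finset.mem_filter.2 ⟨hl, hv.le⟩))
        linarith
      · obtain ⟨n, hn, rfl⟩ := Finset.mem_image.1 htm
        obtain ⟨hn, hnv⟩ := Finset.mem_filter.1 hn
        have := h (l v • n - n v • l) (Finset.mem_union_right _ (Finset.mem_image.2
          ⟨(l, n), by simp [hl, hn, hv, hnv], rfl⟩))
        simp only [LinearMap.sub_apply, LinearMap.smul_apply, smul_eq_mul] at this
        have h2 : n z / n v * l v ≤ l z := by
          rw [div_mul_eq_mul_div, div_le_iff_of_neg hnv]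
          linarith
        linarith

/-- A finitely generated cone is cut out by finitely many linear inequalities. -/
theorem exists_finset_dual_of_finset_generators {V W : Type*} [AddCommGroup V] [Module ℝ V]
    [FiniteDimensional ℝ V] (S : Finset W) (φ : W → V) :
    ∃ N : Finset (Module.Dual ℝ V), ∀ z : V,
      (∃ w : W → ℝ, (∀ s ∈ S, 0 ≤ w s) ∧ ∑ s ∈ S, w s • φ s = z) ↔ ∀ l ∈ N, 0 ≤ l z := by
  classical
  induction S using Finset.induction_on with
  | empty =>
    let b := Module.finBasis ℝ V
    -- Without generators the cone is {0}, cut out by the coordinates and their negatives.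
    refine ⟨Finset.univ.image b.coord ∪ Finset.univ.image (fun i => -b.coord i), fun z => ?_⟩
    constructor
    · rintro ⟨w, -, rfl⟩ l -
      simp
    · intro h
      refine ⟨0, by simp, ?_⟩
      rw [Finset.sum_empty, eq_comm, ← b.forall_coord_eq_zero_iff]
      intro i
      have h1 := h (b.coord i) (by simp)
      have h2 := h (-b.coord i) (by simp)
      rw [LinearMap.neg_apply] at h2
      linarith
  | insert a S ha ih =>
    obtain ⟨N, hN⟩ := ih
    obtain ⟨N', hN'⟩ := exists_finset_dual_add_generator N (φ a)
    refine ⟨N', fun z => ?_⟩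
    rw [← hN' z]
    constructor
    · rintro ⟨w, hw, rfl⟩
      refine ⟨w a, hw a (Finset.mem_insert_self _ _), (hN _).1 ⟨w, fun s hs =>
        hw s (Finset.mem_insert_of_mem hs), ?_⟩⟩
      rw [Finset.sum_insert ha, add_sub_cancel_left]
    · rintro ⟨t, ht, h⟩
      obtain ⟨w, hw, hwz⟩ := (hN _).2 h
      refine ⟨Function.update w a t, fun s hs => ?_, ?_⟩
      · rcases eq_or_ne s a with rfl | hsa
        · simpa
        · rw [Function.update_of_ne hsa]
          exact hw s (Finset.mem_of_mem_insert_of_ne hs hsa)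
      · rw [Finset.sum_insert ha, Function.update_self,
          Finset.sum_congr rfl (g := fun s => w s • φ s), hwz, add_sub_cancel]
        intro s hs
        rw [Function.update_of_ne (by rintro rfl; exact ha hs)]

/-- The intersection of the half-spaces `c.1 x ≤ c.2`. -/
def halfSpaces {V : Type*} [AddCommGroup V] [Module ℝ V]
    (N : Finset (Module.Dual ℝ V × ℝ)) : Set V := {x | ∀ c ∈ N, c.1 x ≤ c.2}

/-- A polytope is an intersection of finitely many half-spaces. -/
theorem exists_convexHull_eq_halfSpaces {V : Type*} [AddCommGroup V] [Module ℝ V]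
    [FiniteDimensional ℝ V] (S : Finset V) :
    ∃ N : Finset (Module.Dual ℝ V × ℝ), convexHull ℝ (S : Set V) = halfSpaces N := by
  classical
  -- Homogenization: the polytope is the slice at height 1 of the cone over it, the last coordinate
  -- recording that the weights sum to 1.
  obtain ⟨N, hN⟩ := exists_finset_dual_of_finset_generators S (fun s : V => (s, (1 : ℝ)))
  refine ⟨N.image fun l => (-(l.comp (LinearMap.inl ℝ V ℝ)), l (0, 1)), Set.ext fun x => ?_⟩
  have key : x ∈ convexHull ℝ (S : Set V) ↔ ∀ l ∈ N, 0 ≤ l (x, (1 : ℝ)) := by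
    rw [← hN, Finset.mem_convexHull']
    refine exists_congr fun w => and_congr_right fun _ => ?_
    rw [Prod.ext_iff]
    simp [Prod.fst_sum, Prod.snd_sum, and_comm]
  have split : ∀ l : Module.Dual ℝ (V × ℝ), l (x, 1) = l (x, 0) + l (0, 1) := fun l => by
    rw [← map_add]; simp
  rw [key]
  simp only [halfSpaces, Set.mem_ofPred_eq, Finset.forall_mem_image, LinearMap.neg_apply,
    LinearMap.comp_apply, LinearMap.inl_apply]
  refine forall₂_congr fun l _ => ?_
  rw [split]
  constructor <;> intro h <;> linarith

/-! ### Faces of an intersection of half-spaces -/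

theorem eventually_add_mul_lt {a b : ℝ} (h : a < b) (d : ℝ) :
    ∀ᶠ s in nhds (0 : ℝ), a + s * d < b := by
  have hc : Continuous fun s : ℝ => a + s * d := by fun_prop
  exact hc.continuousAt.eventually_lt continuousAt_const (by simpa using h)

theorem eventually_lt_add_mul {a b : ℝ} (h : a < b) (d : ℝ) :
    ∀ᶠ s in nhds (0 : ℝ), a < b + s * d := by
  have hc : Continuous fun s : ℝ => b + s * d := by fun_prop
  exact continuousAt_const.eventually_lt hc.continuousAt (by simpa using h)

section Faces

variable {V : Type*} [AddCommGroup V] [Module ℝ V]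

theorem convex_halfSpaces (N : Finset (Module.Dual ℝ V × ℝ)) : Convex ℝ (halfSpaces N) := by
  intro x hx y hy a b ha hb hab c hc
  have h1 := mul_le_mul_of_nonneg_left (hx c hc) ha
  have h2 := mul_le_mul_of_nonneg_left (hy c hc) hb
  simp only [map_add, map_smul, smul_eq_mul]
  nlinarith [show c.2 = a * c.2 + b * c.2 by rw [← add_mul, hab, one_mul]]

/-- The direction space of the minimal face containing `y`: the common kernel of the
constraints that are active at `y`. -/
def activeKer (N : Finset (Module.Dual ℝ V × ℝ)) (y : V) : Submodule ℝ V where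
  carrier := {w | ∀ c ∈ N, c.1 y = c.2 → c.1 w = 0}
  add_mem' {a b} ha hb c hc h := by rw [map_add, ha c hc h, hb c hc h, add_zero]
  zero_mem' c _ _ := map_zero _
  smul_mem' r a ha c hc h := by rw [map_smul, ha c hc h, smul_zero]

variable {N : Finset (Module.Dual ℝ V × ℝ)} {x y z w a b : V}

theorem mem_activeKer : w ∈ activeKer N y ↔ ∀ c ∈ N, c.1 y = c.2 → c.1 w = 0 := Iff.rfl

theorem eventually_add_smul_mem (hy : y ∈ halfSpaces N) (hw : w ∈ activeKer N y) :
    ∀ᶠ s in nhds (0 : ℝ), y + s • w ∈ halfSpaces N := by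
  have : ∀ᶠ s in nhds (0 : ℝ), ∀ c ∈ N, c.1 (y + s • w) ≤ c.2 := by
    rw [Filter.eventually_all_finset]
    intro c hc
    simp only [map_add, map_smul, smul_eq_mul]
    rcases (hy c hc).eq_or_lt with h | h
    · exact Filter.Eventually.of_forall fun s => by rw [hw c hc h, h]; simp
    · exact (eventually_add_mul_lt h _).mono fun s hs => hs.le
  exact this

theorem exists_pos_add_sub_mem (hy : y ∈ halfSpaces N) (hw : w ∈ activeKer N y) :
    ∃ s : ℝ, 0 < s ∧ y + s • w ∈ halfSpaces N ∧ y - s • w ∈ halfSpaces N := by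
  have h1 := eventually_add_smul_mem hy hw
  have h2 := eventually_add_smul_mem hy (Submodule.neg_mem _ hw)
  obtain ⟨s, ⟨h1, h2⟩, hs⟩ := ((h1.and h2).filter_mono nhdsWithin_le_nhds |>.and
    (self_mem_nhdsWithin : Set.Ioi (0 : ℝ) ∈ nhdsWithin 0 (Set.Ioi 0))).exists
  exact ⟨s, hs, h1, by simpa [sub_eq_add_neg] using h2⟩

/-- An inequality that is an equality strictly inside a segment is an equality at both ends. -/
theorem sub_mem_activeKer (ha : a ∈ halfSpaces N) (hb : b ∈ halfSpaces N)
    (hy : y ∈ openSegment ℝ a b) : a - y ∈ activeKer N y := by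
  intro c hc h
  obtain ⟨p, q, hp, hq, hpq, rfl⟩ := hy
  have h1 := mul_le_mul_of_nonneg_left (ha c hc) hp.le
  have h2 := mul_le_mul_of_nonneg_left (hb c hc) hq.le
  have h3 : c.2 = p * c.2 + q * c.2 := by rw [← add_mul, hpq, one_mul]
  rw [map_sub, h]
  simp only [map_add, map_smul, smul_eq_mul] at h
  have : p * c.1 a = p * c.2 := by linarith
  rw [mul_left_cancel₀ hp.ne' this, sub_self]

theorem mem_openSegment_add_sub {s : ℝ} (y w : V) :
    y ∈ openSegment ℝ (y + s • w) (y - s • w) :=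
  ⟨1 / 2, 1 / 2, by norm_num, by norm_num, by norm_num, by
    rw [smul_add, smul_sub, add_add_sub_cancel, ← add_smul]; norm_num⟩

theorem mem_extremePoints_iff_activeKer (hy : y ∈ halfSpaces N) :
    y ∈ (halfSpaces N).extremePoints ℝ ↔ activeKer N y = ⊥ := by
  constructor
  · rintro ⟨-, h⟩
    rw [Submodule.eq_bot_iff]
    intro w hw
    obtain ⟨s, hs, h1, h2⟩ := exists_pos_add_sub_mem hy hw
    have := h h1 h2 (mem_openSegment_add_sub y w)
    rw [add_eq_left] at this
    exact (smul_eq_zero.1 this).resolve_left hs.ne'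
  · intro h
    refine ⟨hy, fun p hp q hq hpq => ?_⟩
    have := sub_mem_activeKer hp hq hpq
    rwa [h, Submodule.mem_bot, sub_eq_zero] at this

theorem active_of_sub_mem (hzy : z - y ∈ activeKer N y) {c : Module.Dual ℝ V × ℝ} (hc : c ∈ N)
    (h : c.1 y = c.2) : c.1 z = c.2 := by
  have := hzy c hc h
  rw [map_sub, sub_eq_zero] at this
  rw [this, h]

theorem activeKer_le_of_sub_mem (hzy : z - y ∈ activeKer N y) :
    activeKer N z ≤ activeKer N y :=
  fun _ hw c hc h => hw c hc (active_of_sub_mem hzy hc h)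

/-- A segment inside the affine hull of the minimal face of `y` that leaves the polyhedron does so
at a point whose minimal face is strictly smaller. -/
theorem exists_exit (hy : y ∈ halfSpaces N) (hw : w ∈ activeKer N y)
    (hout : y + w ∉ halfSpaces N) :
    ∃ t : ℝ, 0 < t ∧ t < 1 ∧ y + t • w ∈ halfSpaces N ∧
      activeKer N (y + t • w) < activeKer N y := by
  have hclosed : IsClosed {t : ℝ | y + t • w ∈ halfSpaces N} := by
    have : {t : ℝ | y + t • w ∈ halfSpaces N} = ⋂ c ∈ N, {t : ℝ | c.1 y + t * c.1 w ≤ c.2} := by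
      ext t; simp [halfSpaces]
    rw [this]
    exact isClosed_biInter fun c _ => isClosed_le (by fun_prop) continuous_const
  -- Take the last parameter still in the polyhedron. If `w` remained in the active kernel there,
  -- one could go further, so a new constraint has become active.
  obtain ⟨t, ⟨htI, ht⟩, hmax⟩ := (isCompact_Icc.inter_right hclosed).exists_isMaxOn
    (s := Set.Icc (0 : ℝ) 1 ∩ {t : ℝ | y + t • w ∈ halfSpaces N}) ⟨0, by simpa using hy⟩
    continuousOn_id
  have ht1 : t < 1 := htI.2.lt_of_ne (by rintro rfl; exact hout (by simpa using ht))
  have hnot : w ∉ activeKer N (y + t • w) := by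
    intro hmem
    have h1 := eventually_add_smul_mem ht hmem
    have h2 : ∀ᶠ s in nhds (0 : ℝ), s < 1 - t := eventually_lt_nhds (by linarith)
    obtain ⟨s, ⟨h1, h2⟩, hs⟩ := ((h1.and h2).filter_mono nhdsWithin_le_nhds |>.and
      (self_mem_nhdsWithin : Set.Ioi (0 : ℝ) ∈ nhdsWithin 0 (Set.Ioi 0))).exists
    have := hmax (a := t + s) ⟨⟨by linarith [htI.1], by linarith⟩, by
      rwa [Set.mem_ofPred_eq, add_smul, ← add_assoc]⟩
    simp only [id, Set.mem_ofPred_eq] at this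
    linarith
  refine ⟨t, htI.1.lt_of_ne ?_, ht1, ht, lt_of_le_of_ne (activeKer_le_of_sub_mem ?_) ?_⟩
  · rintro rfl
    simp [hw] at hnot
  · rw [add_sub_cancel_left]; exact Submodule.smul_mem _ _ hw
  · intro h; exact hnot (h ▸ hw)

/-- If the minimal face of `y` is one-dimensional and bounded, then it is an edge. -/
theorem exists_edge [FiniteDimensional ℝ V] (hy : y ∈ halfSpaces N)
    (hbd : ∀ w : V, w ≠ 0 → ∃ t : ℝ, 0 < t ∧ y + t • w ∉ halfSpaces N)
    (hdim : Module.finrank ℝ (activeKer N y) = 1) :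
    ∃ a b : V, a ∈ (halfSpaces N).extremePoints ℝ ∧ b ∈ (halfSpaces N).extremePoints ℝ ∧ a ≠ b ∧
      IsExtreme ℝ (halfSpaces N) (segment ℝ a b) ∧ y ∈ openSegment ℝ a b ∧
      a - y ∈ activeKer N y ∧ b - y ∈ activeKer N y := by
  obtain ⟨e', he0', hspan⟩ := finrank_eq_one_iff'.1 hdim
  obtain ⟨e, he⟩ := e'
  have he0 : e ≠ 0 := by simpa using he0'
  replace hspan : ∀ w ∈ activeKer N y, ∃ r : ℝ, r • e = w := fun w hw => by
    obtain ⟨r, hr⟩ := hspan ⟨w, hw⟩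
    exact ⟨r, congrArg Subtype.val hr⟩
  -- On leaving the polyhedron the dimension of the minimal face drops below 1, so the exit point is
  -- extreme.
  have ends : ∀ v ∈ activeKer N y, v ≠ 0 →
      ∃ α : ℝ, 0 < α ∧ y + α • v ∈ (halfSpaces N).extremePoints ℝ := by
    intro v hv hv0
    obtain ⟨R, hR, hout⟩ := hbd v hv0
    obtain ⟨t, ht0, -, ht, hlt⟩ := exists_exit hy (Submodule.smul_mem _ R hv) hout
    rw [smul_smul] at ht hlt
    refine ⟨t * R, by positivity, ?_⟩
    rw [mem_extremePoints_iff_activeKer ht, ← Submodule.finrank_eq_zero (R := ℝ)]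
    have := Submodule.finrank_lt_finrank_of_lt hlt
    omega
  obtain ⟨α, hα, hA⟩ := ends e he he0
  obtain ⟨β, hβ, hB⟩ := ends (-e) (Submodule.neg_mem _ he) (neg_ne_zero.2 he0)
  have hinj : ∀ r s : ℝ, y + r • e = y + s • e → r = s := fun r s h =>
    smul_left_injective ℝ he0 (add_left_cancel h)
  have hseg : ∀ r : ℝ, -β ≤ r → r ≤ α → y + r • e ∈ segment ℝ (y + α • e) (y + β • -e) := by
    intro r h1 h2
    refine ⟨(r + β) / (α + β), (α - r) / (α + β), div_nonneg (by linarith) (by linarith),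
      div_nonneg (by linarith) (by linarith), by field_simp; ring, ?_⟩
    have h3 : α + β ≠ 0 := by positivity
    have : ∀ p q : ℝ, p + q = 1 → p * α - q * β = r →
        p • (y + α • e) + q • (y + β • -e) = y + r • e := by
      intro p q h h'
      rw [← h', smul_neg, smul_add, smul_add, smul_neg, sub_smul, smul_smul, smul_smul,
        add_add_add_comm, ← add_smul, h, one_smul, sub_eq_add_neg]
    apply this <;> · field_simp; ring
  have hopen : y ∈ openSegment ℝ (y + α • e) (y + β • -e) := by
    refine ⟨β / (α + β), α / (α + β), by positivity, by positivity, by field_simp; ring, ?_⟩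
    have h3 : α + β ≠ 0 := by positivity
    have h4 : β / (α + β) + α / (α + β) = 1 := by field_simp; ring
    have h5 : β / (α + β) * α = α / (α + β) * β := by ring
    rw [smul_neg, smul_add, smul_add, smul_neg, smul_smul, smul_smul, h5, add_add_add_comm,
      ← add_smul, h4, one_smul, add_neg_cancel, add_zero]
  refine ⟨_, _, hA, hB, ?_, ⟨(convex_halfSpaces N).segment_subset hA.1 hB.1, ?_⟩, hopen, ?_, ?_⟩
  · intro h
    rw [smul_neg, ← neg_smul] at h
    linarith [hinj _ _ h]
  · intro p hp q hq x hx hpq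
    have hline : x - y ∈ activeKer N y := by
      obtain ⟨s, t, -, -, hst, rfl⟩ := hx
      have : s • (y + α • e) + t • (y + β • -e) - y = (s * α - t * β) • e := by
        have hy' : y = s • y + t • y := by rw [← add_smul, hst, one_smul]
        nth_rw 3 [hy']
        simp only [smul_add, smul_neg, sub_smul, smul_smul]
        abel
      rw [this]
      exact Submodule.smul_mem _ _ he
    have hpy : p - y ∈ activeKer N y := by
      rw [← sub_add_sub_cancel p x y]
      exact Submodule.add_mem _ (activeKer_le_of_sub_mem hline (sub_mem_activeKer hp hq hpq)) hline
    obtain ⟨r, hr⟩ := hspan _ hpy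
    obtain rfl : p = y + r • e := by rw [hr, add_sub_cancel]
    -- No point of the polyhedron lies beyond an end on this line: that end would be interior to a
    -- segment.
    have outer : ∀ (v : V) (μ ρ : ℝ), 0 < μ → y + μ • v ∈ (halfSpaces N).extremePoints ℝ →
        y + ρ • v ∈ halfSpaces N → v ≠ 0 → ρ ≤ μ := by
      intro v μ ρ hμ hext hρ hv
      by_contra! hlt
      have hmem : y + μ • v ∈ openSegment ℝ y (y + ρ • v) := by
        have hρ0 : ρ ≠ 0 := (hμ.trans hlt).ne'
        refine ⟨1 - μ / ρ, μ / ρ, ?_, div_pos hμ (hμ.trans hlt), by ring, ?_⟩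
        · rw [sub_pos, div_lt_one (hμ.trans hlt)]; exact hlt
        · rw [smul_add, smul_smul, div_mul_cancel₀ _ hρ0, ← add_assoc, ← add_smul,
            sub_add_cancel, one_smul]
      have := hext.2 hy hρ hmem
      rw [left_eq_add, smul_eq_zero] at this
      exact this.elim hμ.ne' hv
    refine hseg r ?_ (outer e α r hα hA hp he0)
    have := outer (-e) β (-r) hβ hB (by rwa [neg_smul_neg]) (neg_ne_zero.2 he0)
    linarith
  · rw [add_sub_cancel_left]; exact Submodule.smul_mem _ _ he
  · rw [add_sub_cancel_left, smul_neg]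
    exact Submodule.neg_mem _ (Submodule.smul_mem _ _ he)

end Faces

/-! ### Radial description of a polytope and of the cone it generates -/

theorem convex_of_isConvexPolyhedron {P : Set E3} (hP : IsConvexPolyhedron P) : Convex ℝ P := by
  obtain ⟨⟨S, rfl⟩, -⟩ := hP
  exact convex_convexHull ℝ _

theorem isCompact_of_isConvexPolyhedron {P : Set E3} (hP : IsConvexPolyhedron P) :
    IsCompact P := by
  obtain ⟨⟨S, rfl⟩, -⟩ := hP
  exact S.finite_toSet.isCompact_convexHull ℝ

theorem smul_mem_cone {A : Set E3} {x : E3} (hx : x ∈ cone A) {t : ℝ} (ht : 0 ≤ t) :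
    t • x ∈ cone A :=
  (PointedCone.hull ℝ A).smul_mem ht hx

theorem add_mem_cone {A : Set E3} {x y : E3} (hx : x ∈ cone A) (hy : y ∈ cone A) :
    x + y ∈ cone A :=
  (PointedCone.hull ℝ A).add_mem hx hy

theorem subset_cone (A : Set E3) : A ⊆ cone A := PointedCone.subset_hull

theorem exists_smul_of_mem_cone {A : Set E3} (hA : Convex ℝ A) {x : E3} (hx : x ∈ cone A) :
    x = 0 ∨ ∃ t : ℝ, 0 < t ∧ ∃ p ∈ A, x = t • p := by
  induction hx using Submodule.span_induction with
  | mem x hx => exact Or.inr ⟨1, one_pos, x, hx, (one_smul _ _).symm⟩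
  | zero => exact Or.inl rfl
  | add x y _ _ hx hy =>
    rcases hx with rfl | ⟨t, ht, p, hp, rfl⟩
    · simpa using hy
    rcases hy with rfl | ⟨s, hs, q, hq, rfl⟩
    · exact Or.inr ⟨t, ht, p, hp, by simp⟩
    obtain ⟨r, hr, h⟩ := hA.exists_mem_add_smul_eq hp hq ht.le hs.le
    exact Or.inr ⟨t + s, by positivity, r, hr, h.symm⟩
  | smul a x _ hx =>
    rcases eq_or_ne a 0 with rfl | ha
    · left; simp
    rcases hx with rfl | ⟨t, ht, p, hp, rfl⟩
    · left; simp
    · refine Or.inr ⟨a * t, mul_pos (NNReal.coe_pos.2 (pos_iff_ne_zero.2 ha)) ht, p, hp, ?_⟩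
      exact smul_smul (a : ℝ) t p

theorem exists_add_smul_notMem {P : Set E3} (hP : IsCompact P) (p : E3) {w : E3} (hw : w ≠ 0) :
    ∃ t : ℝ, 0 < t ∧ p + t • w ∉ P := by
  obtain ⟨R, hR⟩ := hP.isBounded.exists_norm_le
  have hw' : 0 < ‖w‖ := norm_pos_iff.2 hw
  refine ⟨(|R| + ‖p‖ + 1) / ‖w‖, by positivity, fun h => ?_⟩
  have h1 := hR _ h
  have h2 := norm_sub_norm_le (((|R| + ‖p‖ + 1) / ‖w‖) • w) (-p)
  rw [norm_smul, Real.norm_of_nonneg (by positivity), div_mul_cancel₀ _ hw'.ne', norm_neg,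
    sub_neg_eq_add, add_comm _ p] at h2
  linarith [le_abs_self R]

/-- The ray contains the origin, so with `0 ∈ P` its only point in `P` would be 0; but its direction
is a positive multiple of a point of `P`, which lies on the ray too. -/
theorem zero_notMem_of_ray {P : Set E3} (hP : Convex ℝ P)
    (hray : ∃ τ ∈ extremalRays P, ∃ A : E3, τ ∩ P = {A}) : (0 : E3) ∉ P := by
  intro h0
  obtain ⟨τ, ⟨v, hv, rfl, hext⟩, A, hA⟩ := hray
  have h0A : (0 : E3) ∈ ray v ∩ P := ⟨⟨0, le_rfl, by simp⟩, h0⟩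
  rw [hA, Set.mem_singleton_iff] at h0A
  subst h0A
  have hvC : v ∈ cone P := hext.subset ⟨1, zero_le_one, by simp⟩
  rcases exists_smul_of_mem_cone hP hvC with h | ⟨t, ht, p, hp, h⟩
  · exact hv h
  have : p ∈ ray v ∩ P :=
    ⟨⟨t⁻¹, by positivity, by rw [h, smul_smul, inv_mul_cancel₀ ht.ne', one_smul]⟩, hp⟩
  rw [hA, Set.mem_singleton_iff] at this
  rw [this, smul_zero] at h
  exact hv h

/-- A description of the polytope `P` by functionals adapted to the rays through the origin: `I`
cuts out the far side of `P`, `J` the near side, and `H` the cone generated by `P`. -/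
structure RadialData (P : Set E3) (I J H : Finset (Module.Dual ℝ E3)) : Prop where
  mem_iff : ∀ x, x ∈ P ↔ (∀ f ∈ I, f x ≤ 1) ∧ (∀ g ∈ J, 1 ≤ g x) ∧ ∀ h ∈ H, 0 ≤ h x
  mem_cone_iff : ∀ x, x ∈ cone P ↔ ∀ h ∈ H, 0 ≤ h x
  le_of_mem_cone : ∀ x ∈ cone P, ∀ f ∈ I, ∀ g ∈ J, f x ≤ g x
  exists_pos : ∀ x ∈ cone P, x ≠ 0 → ∃ f ∈ I, 0 < f x
  near_nonempty : J.Nonempty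
  convex : Convex ℝ P
  compact : IsCompact P
  finite_vertices : (vertices P).Finite

/-- Because `0 ∉ P`, some facet inequality has negative constant term. Dividing by a nonzero
constant term turns an inequality into f ≤ 1 or g ≥ 1 according to its sign; the homogeneous ones
already concern the cone. -/
theorem exists_radialData {P : Set E3} (hP : IsConvexPolyhedron P) (h0 : (0 : E3) ∉ P) :
    ∃ I J H : Finset (Module.Dual ℝ E3), RadialData P I J H := by
  classical
  have hconv := convex_of_isConvexPolyhedron hP
  have hcomp := isCompact_of_isConvexPolyhedron hP
  have hfin : (vertices P).Finite := by
    obtain ⟨⟨S, rfl⟩, -⟩ := hP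
    exact S.finite_toSet.subset extremePoints_convexHull_subset
  obtain ⟨⟨S, hS⟩, hint⟩ := hP
  obtain ⟨N, hN⟩ := exists_convexHull_eq_halfSpaces S
  rw [← hS] at hN
  have hmem : ∀ x, x ∈ P ↔ ∀ c ∈ N, c.1 x ≤ c.2 := fun x => by rw [hN]; rfl
  obtain ⟨p₀, hp₀⟩ := hint.mono interior_subset
  let I := (N.filter fun c => 0 < c.2).image fun c => c.2⁻¹ • c.1
  let J := (N.filter fun c => c.2 < 0).image fun c => c.2⁻¹ • c.1
  let H₀ := (N.filter fun c => c.2 = 0).image fun c => -c.1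
  -- A ray meets `P` only if every f is at most every g on it. These differences, together with `J`
  -- itself, complete the inequalities of the cone.
  let H₁ := (I ×ˢ J).image fun q => q.2 - q.1
  have hsplit : ∀ x, x ∈ P ↔ (∀ f ∈ I, f x ≤ 1) ∧ (∀ g ∈ J, 1 ≤ g x) ∧ ∀ h ∈ H₀, 0 ≤ h x := by
    intro x
    rw [hmem]
    simp only [I, J, H₀, Finset.forall_mem_image, Finset.mem_filter, and_imp,
      LinearMap.smul_apply, LinearMap.neg_apply, smul_eq_mul]
    constructor
    · intro h
      refine ⟨fun c hc h1 => ?_, fun c hc h1 => ?_, fun c hc h1 => ?_⟩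
      · rw [inv_mul_le_iff₀ h1, mul_one]; exact h c hc
      · rw [← div_eq_inv_mul, le_div_iff_of_neg h1, one_mul]; exact h c hc
      · have := h c hc; linarith
    · rintro ⟨h1, h2, h3⟩ c hc
      rcases lt_trichotomy c.2 0 with h | h | h
      · have := h2 hc h
        rwa [← div_eq_inv_mul, le_div_iff_of_neg h, one_mul] at this
      · have := h3 hc h; linarith
      · have := h1 hc h
        rwa [inv_mul_le_iff₀ h, mul_one] at this
  have hH : ∀ x : E3, (∀ h ∈ H₀ ∪ H₁ ∪ J, 0 ≤ h x) ↔
      (∀ h ∈ H₀, 0 ≤ h x) ∧ (∀ f ∈ I, ∀ g ∈ J, f x ≤ g x) ∧ ∀ g ∈ J, 0 ≤ g x := by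
    intro x
    simp only [Finset.forall_mem_union, H₁, Finset.forall_mem_image, Finset.mem_product,
      LinearMap.sub_apply, sub_nonneg, Prod.forall, and_assoc]
    refine and_congr_right fun _ => and_congr_left fun _ => ?_
    exact ⟨fun h f hf g hg => h f g ⟨hf, hg⟩, fun h f g hq => h f hq.1 g hq.2⟩
  -- If no far functional were positive at `x`, then `P` would contain the whole half-line from `p₀`
  -- in the direction `x`, contrary to boundedness.
  have hpos : ∀ x, (∀ h ∈ H₀ ∪ H₁ ∪ J, 0 ≤ h x) → x ≠ 0 → ∃ f ∈ I, 0 < f x := by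
    intro x hx hx0
    by_contra! hf
    obtain ⟨h1, h2, h3⟩ := (hH x).1 hx
    obtain ⟨t, ht, hout⟩ := exists_add_smul_notMem hcomp p₀ hx0
    apply hout
    obtain ⟨q1, q2, q3⟩ := (hsplit p₀).1 hp₀
    rw [hsplit]
    simp only [map_add, map_smul, smul_eq_mul]
    refine ⟨fun f hfI => ?_, fun g hg => ?_, fun h hh => ?_⟩
    · nlinarith [q1 f hfI, mul_nonneg ht.le (neg_nonneg.2 (hf f hfI))]
    · nlinarith [q2 g hg, mul_nonneg ht.le (h3 g hg)]
    · exact add_nonneg (q3 h hh) (mul_nonneg ht.le (h1 h hh))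
  have hPH : ∀ x ∈ P, ∀ h ∈ H₀ ∪ H₁ ∪ J, 0 ≤ h x := by
    intro x hx
    obtain ⟨q1, q2, q3⟩ := (hsplit x).1 hx
    exact (hH x).2 ⟨q3, fun f hf g hg => (q1 f hf).trans (q2 g hg),
      fun g hg => zero_le_one.trans (q2 g hg)⟩
  have hcone : ∀ x, x ∈ cone P ↔ ∀ h ∈ H₀ ∪ H₁ ∪ J, 0 ≤ h x := by
    intro x
    constructor
    · intro hx h hh
      rcases exists_smul_of_mem_cone hconv hx with rfl | ⟨t, ht, p, hp, rfl⟩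
      · simp
      · rw [map_smul, smul_eq_mul]
        exact mul_nonneg ht.le (hPH p hp h hh)
    · intro hx
      rcases eq_or_ne x 0 with rfl | hx0
      · exact (PointedCone.hull ℝ P).zero_mem
      obtain ⟨f₀, hf₀, hf₀x⟩ := hpos x hx hx0
      obtain ⟨f, hf, hmax⟩ := Finset.exists_max_image I (fun f => f x) ⟨f₀, hf₀⟩
      have hfx : 0 < f x := hf₀x.trans_le (hmax f₀ hf₀)
      obtain ⟨h1, h2, h3⟩ := (hH x).1 hx
      have hp : (f x)⁻¹ • x ∈ P := by
        rw [hsplit]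
        simp only [map_smul, smul_eq_mul]
        refine ⟨fun f' hf' => ?_, fun g hg => ?_, fun h hh => ?_⟩
        · rw [inv_mul_le_iff₀ hfx, mul_one]; exact hmax f' hf'
        · rw [le_inv_mul_iff₀ hfx, mul_one]; exact h2 f hf g hg
        · exact mul_nonneg (inv_pos.2 hfx).le (h1 h hh)
      have := smul_mem_cone (subset_cone P hp) hfx.le
      rwa [smul_smul, mul_inv_cancel₀ hfx.ne', one_smul] at this
  refine ⟨I, J, H₀ ∪ H₁ ∪ J, ?_, hcone, ?_, ?_, ?_, hconv, hcomp, hfin⟩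
  · intro x
    constructor
    · intro hx
      exact ⟨((hsplit x).1 hx).1, ((hsplit x).1 hx).2.1, hPH x hx⟩
    · rintro ⟨h1, h2, h3⟩
      exact (hsplit x).2 ⟨h1, h2, ((hH x).1 h3).1⟩
  · exact fun x hx => ((hH x).1 ((hcone x).1 hx)).2.1
  · exact fun x hx => hpos x ((hcone x).1 hx)
  · obtain ⟨c, hc, hc0⟩ : ∃ c ∈ N, c.2 < 0 := by
      by_contra! h
      exact h0 ((hmem 0).2 fun c hc => by simpa using h c hc)
    exact ⟨c.2⁻¹ • c.1, Finset.mem_image_of_mem _ (Finset.mem_filter.2 ⟨hc, hc0⟩)⟩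

/-- The constraints of `RadialData`, written as half-spaces. -/
noncomputable def constraints (I J H : Finset (Module.Dual ℝ E3)) :
    Finset (Module.Dual ℝ E3 × ℝ) := by
  classical
  exact I.image (fun f => (f, 1)) ∪ J.image (fun g => (-g, -1)) ∪ H.image (fun h => (-h, 0))

theorem forall_mem_constraints {I J H : Finset (Module.Dual ℝ E3)}
    {p : Module.Dual ℝ E3 × ℝ → Prop} :
    (∀ c ∈ constraints I J H, p c) ↔
      (∀ f ∈ I, p (f, 1)) ∧ (∀ g ∈ J, p (-g, -1)) ∧ ∀ h ∈ H, p (-h, 0) := by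
  classical
  simp only [constraints, Finset.forall_mem_union, Finset.forall_mem_image, and_assoc]

theorem mem_activeKer_constraints {I J H : Finset (Module.Dual ℝ E3)} {y w : E3} :
    w ∈ activeKer (constraints I J H) y ↔ (∀ f ∈ I, f y = 1 → f w = 0) ∧
      (∀ g ∈ J, g y = 1 → g w = 0) ∧ ∀ h ∈ H, h y = 0 → h w = 0 := by
  rw [mem_activeKer, forall_mem_constraints]
  simp

namespace RadialData

variable {P : Set E3} {I J H : Finset (Module.Dual ℝ E3)} (D : RadialData P I J H)
include D

theorem eq_halfSpaces : P = halfSpaces (constraints I J H) := by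
  ext x
  rw [D.mem_iff]
  change _ ↔ ∀ c ∈ constraints I J H, c.1 x ≤ c.2
  rw [forall_mem_constraints]
  simp

end RadialData

/-! ### Relative interiors, vertex classes and `L P k` in terms of the radial functionals -/

theorem mem_relInterior {C X : Set E3} {x : E3} :
    x ∈ relInterior C X ↔ x ∈ C ∧ X ∈ nhdsWithin x C := by
  constructor
  · rintro ⟨⟨x, hx⟩, h, rfl⟩
    exact ⟨hx, by rwa [mem_interior_iff_mem_nhds, preimage_coe_mem_nhds_subtype] at h⟩
  · rintro ⟨hx, h⟩
    exact ⟨⟨x, hx⟩, by rwa [mem_interior_iff_mem_nhds, preimage_coe_mem_nhds_subtype], rfl⟩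

theorem exists_pos_lt_of_eventually {p : ℝ → Prop} (h : ∀ᶠ s in nhds (0 : ℝ), p s) {δ : ℝ}
    (hδ : 0 < δ) : ∃ s : ℝ, 0 < s ∧ s < δ ∧ p s := by
  obtain ⟨s, ⟨h1, h2⟩, hs⟩ := ((h.and (eventually_lt_nhds hδ)).filter_mono
    nhdsWithin_le_nhds |>.and
    (self_mem_nhdsWithin : Set.Ioi (0 : ℝ) ∈ nhdsWithin 0 (Set.Ioi 0))).exists
  exact ⟨s, hs, h2, h1⟩

theorem segment_smul_smul {a b : ℝ} (hab : a ≤ b) (A : E3) :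
    segment ℝ (a • A) (b • A) = {x | ∃ s, a ≤ s ∧ s ≤ b ∧ x = s • A} := by
  have := image_segment ℝ (LinearMap.toSpanSingleton ℝ E3 A).toAffineMap a b
  rw [segment_eq_Icc hab] at this
  simp only [LinearMap.coe_toAffineMap, LinearMap.toSpanSingleton_apply] at this
  rw [← this]
  ext x
  simp [and_assoc, eq_comm]

namespace RadialData

variable {P : Set E3} {I J H : Finset (Module.Dual ℝ E3)} (D : RadialData P I J H)
include D

theorem zero_notMem : (0 : E3) ∉ P := by
  intro h
  obtain ⟨g, hg⟩ := D.near_nonempty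
  have := ((D.mem_iff 0).1 h).2.1 g hg
  rw [map_zero] at this
  linarith

theorem ne_zero_of_mem {x : E3} (hx : x ∈ P) : x ≠ 0 := fun h => D.zero_notMem (h ▸ hx)

theorem mem_iff_cone (x : E3) :
    x ∈ P ↔ (∀ f ∈ I, f x ≤ 1) ∧ (∀ g ∈ J, 1 ≤ g x) ∧ x ∈ cone P := by
  rw [D.mem_iff, D.mem_cone_iff]

theorem mem_smul_iff {t : ℝ} (ht : 0 < t) (x : E3) :
    x ∈ t • P ↔ (∀ f ∈ I, f x ≤ t) ∧ (∀ g ∈ J, t ≤ g x) ∧ x ∈ cone P := by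
  rw [Set.mem_smul_set_iff_inv_smul_mem₀ ht.ne', D.mem_iff_cone]
  simp only [map_smul, smul_eq_mul, inv_mul_le_iff₀ ht, le_inv_mul_iff₀ ht, mul_one]
  refine and_congr_right fun _ => and_congr_right fun _ => ⟨fun h => ?_, fun h =>
    smul_mem_cone h (inv_nonneg.2 ht.le)⟩
  have := smul_mem_cone h ht.le
  rwa [smul_smul, mul_inv_cancel₀ ht.ne', one_smul] at this

theorem pos_near {x : E3} (hx : x ∈ cone P) (hx0 : x ≠ 0) {g : Module.Dual ℝ E3} (hg : g ∈ J) :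
    0 < g x := by
  obtain ⟨f, hf, h⟩ := D.exists_pos x hx hx0
  exact h.trans_le (D.le_of_mem_cone x hx f hf g hg)

theorem exists_max_far {x : E3} (hx : x ∈ cone P) (hx0 : x ≠ 0) :
    ∃ f ∈ I, 0 < f x ∧ ∀ f' ∈ I, f' x ≤ f x := by
  obtain ⟨f₀, hf₀, h₀⟩ := D.exists_pos x hx hx0
  obtain ⟨f, hf, hmax⟩ := Finset.exists_max_image I (fun f => f x) ⟨f₀, hf₀⟩
  exact ⟨f, hf, h₀.trans_le (hmax f₀ hf₀), hmax⟩

theorem exists_min_near (x : E3) : ∃ g ∈ J, ∀ g' ∈ J, g x ≤ g' x :=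
  Finset.exists_min_image J (fun g => g x) D.near_nonempty

theorem isClosed_cone : IsClosed (cone P) := by
  have : cone P = ⋂ h ∈ H, {x : E3 | 0 ≤ h x} := by
    ext x; simp [D.mem_cone_iff]
  rw [this]
  exact isClosed_biInter fun h _ => isClosed_le continuous_const
    (LinearMap.continuous_of_finiteDimensional h)

/-- If every nonzero functional of `H` were positive at `y`, all would stay nonnegative nearby. The
zero functional has to be excluded, as `H` may contain it. -/
theorem exists_of_mem_frontier {y : E3} (hy : y ∈ frontier (cone P)) :
    ∃ h ∈ H, h ≠ 0 ∧ h y = 0 := by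
  by_contra! hne
  have hyC : y ∈ cone P := D.isClosed_cone.frontier_subset hy
  apply hy.2
  rw [mem_interior_iff_mem_nhds]
  have : ∀ᶠ z in nhds y, ∀ h ∈ H, 0 ≤ h z := by
    rw [Filter.eventually_all_finset]
    intro h hh
    rcases eq_or_ne h 0 with rfl | h0
    · exact Filter.Eventually.of_forall fun z => le_rfl
    · have hpos : 0 < h y := ((D.mem_cone_iff y).1 hyC h hh).lt_of_ne (hne h hh h0).symm
      exact ((LinearMap.continuous_of_finiteDimensional h).continuousAt.eventually
        (lt_mem_nhds hpos)).mono fun z hz => hz.le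
  exact this.mono fun z hz => (D.mem_cone_iff z).2 hz

/-- Strictness is tested by moving radially, which never leaves the cone: outwards for the far
functionals, inwards for the near ones. -/
theorem mem_relInterior_smul_iff {t : ℝ} (ht : 0 < t) (x : E3) :
    x ∈ relInterior (cone P) (t • P) ↔
      x ∈ cone P ∧ (∀ f ∈ I, f x < t) ∧ ∀ g ∈ J, t < g x := by
  rw [mem_relInterior]
  refine and_congr_right fun hx => ⟨fun h => ?_, fun ⟨h1, h2⟩ => ?_⟩
  · have hlim : Filter.Tendsto (fun s : ℝ => x + s • x) (nhds 0) (nhdsWithin x (cone P)) := by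
      rw [tendsto_nhdsWithin_iff]
      constructor
      · have : Continuous fun s : ℝ => x + s • x := by fun_prop
        simpa using this.tendsto 0
      · filter_upwards [lt_mem_nhds (show (-1 : ℝ) < 0 by norm_num)] with s hs
        have := smul_mem_cone hx (show 0 ≤ 1 + s by linarith)
        rwa [add_smul, one_smul] at this
    have hev : ∀ᶠ s in nhds (0 : ℝ), x + s • x ∈ t • P := hlim.eventually h
    have hev' : ∀ᶠ s in nhds (0 : ℝ), x + (-s) • x ∈ t • P :=
      (hlim.comp (by simpa using (continuous_neg (G := ℝ)).tendsto 0)).eventually h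
    obtain ⟨s, hs, -, h1⟩ := exists_pos_lt_of_eventually hev one_pos
    obtain ⟨r, hr, hr1, h2⟩ := exists_pos_lt_of_eventually hev' one_pos
    rw [D.mem_smul_iff ht] at h1 h2
    refine ⟨fun f hf => ?_, fun g hg => ?_⟩
    · have := h1.1 f hf
      simp only [map_add, map_smul, smul_eq_mul] at this
      by_contra! hle
      nlinarith
    · have := h2.2.1 g hg
      simp only [map_add, map_smul, smul_eq_mul] at this
      by_contra! hle
      nlinarith
  · have hopen : ∀ᶠ z in nhds x, (∀ f ∈ I, f z < t) ∧ ∀ g ∈ J, t < g z := by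
      refine Filter.Eventually.and ?_ ?_
      · rw [Filter.eventually_all_finset]
        exact fun f hf => (LinearMap.continuous_of_finiteDimensional f).continuousAt.eventually
          (gt_mem_nhds (h1 f hf))
      · rw [Filter.eventually_all_finset]
        exact fun g hg => (LinearMap.continuous_of_finiteDimensional g).continuousAt.eventually
          (lt_mem_nhds (h2 g hg))
    filter_upwards [nhdsWithin_le_nhds hopen, self_mem_nhdsWithin] with z hz hzC
    rw [D.mem_smul_iff ht]
    exact ⟨fun f hf => (hz.1 f hf).le, fun g hg => (hz.2 g hg).le, hzC⟩

theorem mem_relBoundary_iff (x : E3) :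
    x ∈ relBoundary (cone P) P ↔ x ∈ P ∧ ((∃ f ∈ I, f x = 1) ∨ ∃ g ∈ J, g x = 1) := by
  have h1 : x ∈ relBoundary (cone P) P ↔ x ∈ P ∧ x ∉ relInterior (cone P) P := by
    have hcl : IsClosed ((Subtype.val : cone P → E3) ⁻¹' P) :=
      D.compact.isClosed.preimage continuous_subtype_val
    rw [relBoundary, hcl.frontier_eq]
    constructor
    · rintro ⟨z, ⟨hz, hz'⟩, rfl⟩
      refine ⟨hz, ?_⟩
      rintro ⟨z', h, hzz⟩
      exact hz' (Subtype.ext hzz ▸ h)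
    · rintro ⟨hx, hx'⟩
      exact ⟨⟨x, subset_cone P hx⟩, ⟨hx, fun h => hx' ⟨_, h, rfl⟩⟩, rfl⟩
  rw [h1]
  refine and_congr_right fun hx => ?_
  have h2 := D.mem_relInterior_smul_iff one_pos x
  rw [one_smul] at h2
  rw [h2]
  obtain ⟨q1, q2, q3⟩ := (D.mem_iff_cone x).1 hx
  constructor
  · intro h
    by_contra! h'
    exact h ⟨q3, fun f hf => (q1 f hf).lt_of_ne (h'.1 f hf),
      fun g hg => (q2 g hg).lt_of_ne (h'.2 g hg).symm⟩
  · rintro (⟨f, hf, h⟩ | ⟨g, hg, h⟩) ⟨-, h3, h4⟩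
    · exact (h3 f hf).ne h
    · exact (h4 g hg).ne' h

/-- A point of `P` is a vertex if and only if its minimal face has trivial direction space. -/
theorem mem_vertices_iff {y : E3} (hy : y ∈ P) :
    y ∈ vertices P ↔ activeKer (constraints I J H) y = ⊥ := by
  have := D.eq_halfSpaces
  rw [vertices, this, mem_extremePoints_iff_activeKer (this ▸ hy)]

/-- If only homogeneous constraints were active, the radial direction `A` would lie in the direction
space of the minimal face of the vertex. -/
theorem exists_active_of_mem_vertices {A : E3} (hA : A ∈ vertices P) :
    (∃ f ∈ I, f A = 1) ∨ ∃ g ∈ J, g A = 1 := by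
  by_contra! h
  have hb := (D.mem_vertices_iff hA.1).1 hA
  have : A ∈ activeKer (constraints I J H) A :=
    mem_activeKer_constraints.2 ⟨fun f hf h' => absurd h' (h.1 f hf),
      fun g hg h' => absurd h' (h.2 g hg), fun _ _ h' => h'⟩
  rw [hb, Submodule.mem_bot] at this
  exact D.ne_zero_of_mem hA.1 this

/-- The ends of the radial segment are 1 / min g and 1 / max f, both evaluated at `A`. -/
theorem exists_ray_inter_eq {A : E3} (hA : A ∈ P) :
    ∃ a b : ℝ, 0 < a ∧ a ≤ 1 ∧ 1 ≤ b ∧ ray A ∩ P = segment ℝ (a • A) (b • A) ∧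
      (∃ f ∈ I, b * f A = 1) ∧ ∃ g ∈ J, a * g A = 1 := by
  have hC := subset_cone P hA
  have h0 := D.ne_zero_of_mem hA
  obtain ⟨q1, q2, -⟩ := (D.mem_iff_cone A).1 hA
  obtain ⟨f, hf, hf0, hfmax⟩ := D.exists_max_far hC h0
  obtain ⟨g, hg, hgmin⟩ := D.exists_min_near A
  have hg0 : 0 < g A := D.pos_near hC h0 hg
  have hb : 1 ≤ (f A)⁻¹ := (one_le_inv₀ hf0).2 (q1 f hf)
  have ha : (g A)⁻¹ ≤ 1 := inv_le_one_of_one_le₀ (q2 g hg)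
  refine ⟨(g A)⁻¹, (f A)⁻¹, inv_pos.2 hg0, ha, hb, ?_, ⟨f, hf, inv_mul_cancel₀ hf0.ne'⟩,
    g, hg, inv_mul_cancel₀ hg0.ne'⟩
  rw [segment_smul_smul (ha.trans hb)]
  ext x
  constructor
  · rintro ⟨⟨s, hs, rfl⟩, hsP⟩
    obtain ⟨p1, p2, -⟩ := (D.mem_iff_cone _).1 hsP
    have h1 := p1 f hf
    have h2 := p2 g hg
    rw [map_smul, smul_eq_mul] at h1 h2
    exact ⟨s, (inv_le_iff_one_le_mul₀ hg0).2 h2, by rwa [← one_div, le_div_iff₀ hf0],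
      rfl⟩
  · rintro ⟨s, h1, h2, rfl⟩
    have hs : 0 < s := (inv_pos.2 hg0).trans_le h1
    refine ⟨⟨s, hs.le, rfl⟩, (D.mem_iff_cone _).2 ⟨fun f' hf' => ?_, fun g' hg' => ?_,
      smul_mem_cone hC hs.le⟩⟩
    · rw [map_smul, smul_eq_mul]
      have := mul_le_mul_of_nonneg_left (hfmax f' hf') hs.le
      have h3 := mul_le_mul_of_nonneg_right h2 hf0.le
      rw [inv_mul_cancel₀ hf0.ne'] at h3
      linarith
    · rw [map_smul, smul_eq_mul]
      have := mul_le_mul_of_nonneg_left (hgmin g' hg') hs.le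
      have h3 := mul_le_mul_of_nonneg_right h1 hg0.le
      rw [inv_mul_cancel₀ hg0.ne'] at h3
      linarith

theorem mem_W_iff {A : E3} :
    A ∈ W P ↔ A ∈ vertices P ∧ (∃ f ∈ I, f A = 1) ∧ ∃ g ∈ J, g A = 1 := by
  refine and_congr_right fun hA => ?_
  obtain ⟨a, b, ha0, ha, hb, hray, ⟨f, hf, hfb⟩, g, hg, hga⟩ := D.exists_ray_inter_eq hA.1
  have h0 := D.ne_zero_of_mem hA.1
  rw [IsOtherEnd, hray, segment_same]
  constructor
  · intro h
    have h1 : a • A = A := h.subset (left_mem_segment ℝ _ _)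
    have h2 : b • A = A := h.subset (right_mem_segment ℝ _ _)
    have h1' : a = 1 := smul_left_injective ℝ h0 (by simpa using h1)
    have h2' : b = 1 := smul_left_injective ℝ h0 (by simpa using h2)
    subst h1' h2'
    exact ⟨⟨f, hf, by simpa using hfb⟩, g, hg, by simpa using hga⟩
  · rintro ⟨⟨f', hf', h1⟩, g', hg', h2⟩
    have hmem : a • A ∈ P ∧ b • A ∈ P :=
      ⟨(hray.superset (left_mem_segment ℝ _ _)).2, (hray.superset (right_mem_segment ℝ _ _)).2⟩
    have h3 := ((D.mem_iff_cone _).1 hmem.1).2.1 g' hg'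
    have h4 := ((D.mem_iff_cone _).1 hmem.2).1 f' hf'
    rw [map_smul, smul_eq_mul, h2, mul_one] at h3
    rw [map_smul, smul_eq_mul, h1, mul_one] at h4
    rw [le_antisymm ha h3, le_antisymm h4 hb, one_smul, segment_same]

/-- The union forgets whether the ray is extremal. A vertex with all far functionals below 1 has an
active near one, hence is the near end of a proper segment. -/
theorem mem_near_iff {A : E3} :
    A ∈ V₁ P ∪ W₁ P ↔ A ∈ vertices P ∧ ∀ f ∈ I, f A < 1 := by
  have h1 : A ∈ V₁ P ∪ W₁ P ↔ A ∈ vertices P ∧ ∃ A', IsOtherEnd P A A' ∧ ‖A‖ < ‖A'‖ := by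
    simp only [V₁, W₁, Set.mem_union, Set.mem_ofPred_eq]
    by_cases h : A ∈ extremalPoints P <;> simp [h]
  rw [h1]
  refine and_congr_right fun hA => ?_
  have h0 := D.ne_zero_of_mem hA.1
  constructor
  · rintro ⟨A', hA', hlt⟩ f hf
    obtain ⟨⟨r, hr, rfl⟩, hrP⟩ : A' ∈ ray A ∩ P := by rw [hA']; exact right_mem_segment ℝ _ _
    rw [norm_smul, Real.norm_of_nonneg hr] at hlt
    have hr1 : 1 < r := by
      by_contra! hle
      nlinarith [norm_nonneg A]
    have := ((D.mem_iff_cone _).1 hrP).1 f hf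
    rw [map_smul, smul_eq_mul] at this
    by_contra! hle
    nlinarith
  · intro hlt
    obtain ⟨a, b, ha0, ha, hb, hray, ⟨f, hf, hfb⟩, g, hg, hga⟩ := D.exists_ray_inter_eq hA.1
    obtain ⟨f', hf', h⟩ | ⟨g', hg', h2⟩ := D.exists_active_of_mem_vertices hA
    · exact absurd h (hlt f' hf').ne
    have h3 := ((D.mem_iff_cone _).1 (hray.superset (left_mem_segment ℝ _ _)).2).2.1 g' hg'
    rw [map_smul, smul_eq_mul, h2, mul_one] at h3
    rw [le_antisymm ha h3, one_smul] at hray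
    refine ⟨b • A, hray, ?_⟩
    have hb1 : 1 < b := by
      refine hb.lt_of_ne ?_
      rintro rfl
      rw [one_mul] at hfb
      exact (hlt f hf).ne hfb
    rw [norm_smul, Real.norm_of_nonneg (by linarith)]
    nlinarith [norm_pos_iff.2 h0]

theorem mem_far_iff {A : E3} :
    A ∈ V₂ P ∪ W₂ P ↔ A ∈ vertices P ∧ ∀ g ∈ J, 1 < g A := by
  have h1 : A ∈ V₂ P ∪ W₂ P ↔ A ∈ vertices P ∧ ∃ A', IsOtherEnd P A A' ∧ ‖A'‖ < ‖A‖ := by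
    simp only [V₂, W₂, Set.mem_union, Set.mem_ofPred_eq]
    by_cases h : A ∈ extremalPoints P <;> simp [h]
  rw [h1]
  refine and_congr_right fun hA => ?_
  have h0 := D.ne_zero_of_mem hA.1
  constructor
  · rintro ⟨A', hA', hlt⟩ g hg
    obtain ⟨⟨r, hr, rfl⟩, hrP⟩ : A' ∈ ray A ∩ P := by rw [hA']; exact right_mem_segment ℝ _ _
    rw [norm_smul, Real.norm_of_nonneg hr] at hlt
    have hr1 : r < 1 := by
      by_contra! hle
      nlinarith [norm_nonneg A]
    have := ((D.mem_iff_cone _).1 hrP).2.1 g hg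
    rw [map_smul, smul_eq_mul] at this
    by_contra! hle
    nlinarith
  · intro hlt
    obtain ⟨a, b, ha0, ha, hb, hray, ⟨f, hf, hfb⟩, g, hg, hga⟩ := D.exists_ray_inter_eq hA.1
    obtain ⟨f', hf', h2⟩ | ⟨g', hg', h⟩ := D.exists_active_of_mem_vertices hA
    swap
    · exact absurd h (hlt g' hg').ne'
    have h3 := ((D.mem_iff_cone _).1 (hray.superset (right_mem_segment ℝ _ _)).2).1 f' hf'
    rw [map_smul, smul_eq_mul, h2, mul_one] at h3
    rw [le_antisymm h3 hb, one_smul, segment_symm] at hray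
    refine ⟨a • A, hray, ?_⟩
    have ha1 : a < 1 := by
      refine ha.lt_of_ne ?_
      rintro rfl
      rw [one_mul] at hga
      exact (hlt g hg).ne' hga
    rw [norm_smul, Real.norm_of_nonneg ha0.le]
    nlinarith [norm_pos_iff.2 h0]

theorem vertex_cases {A : E3} (hA : A ∈ vertices P) :
    A ∈ W P ∨ A ∈ V₁ P ∪ W₁ P ∨ A ∈ V₂ P ∪ W₂ P := by
  rw [D.mem_W_iff, D.mem_near_iff, D.mem_far_iff]
  obtain ⟨q1, q2, -⟩ := (D.mem_iff_cone A).1 hA.1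
  by_cases h1 : ∃ f ∈ I, f A = 1
  · by_cases h2 : ∃ g ∈ J, g A = 1
    · exact Or.inl ⟨hA, h1, h2⟩
    · push Not at h2
      exact Or.inr (Or.inr ⟨hA, fun g hg => (q2 g hg).lt_of_ne (h2 g hg).symm⟩)
  · push Not at h1
    exact Or.inr (Or.inl ⟨hA, fun f hf => (q1 f hf).lt_of_ne (h1 f hf)⟩)

theorem eq_of_mem_W_of_smul_mem {A : E3} (hA : A ∈ W P) {r : ℝ} (h : r • A ∈ P) :
    r • A = A := by
  obtain ⟨-, ⟨f, hf, h1⟩, g, hg, h2⟩ := D.mem_W_iff.1 hA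
  obtain ⟨q1, q2, -⟩ := (D.mem_iff_cone _).1 h
  have h3 := q1 f hf
  have h4 := q2 g hg
  rw [map_smul, smul_eq_mul, h1, mul_one] at h3
  rw [map_smul, smul_eq_mul, h2, mul_one] at h4
  rw [le_antisymm h3 h4, one_smul]

/-- Points of the hull satisfy f ≤ k + 1 and g ≥ k automatically, so missing `k • P` can only mean
that some f exceeds k, and missing the larger dilate that some g is below k + 1. -/
theorem mem_L_iff {k : ℕ} (hk : 0 < k) (x : E3) :
    x ∈ L P k ↔ x ∈ cone P ∧ (∃ f ∈ I, (k : ℝ) < f x) ∧ ∃ g ∈ J, g x < (k : ℝ) + 1 := by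
  have hk0 : (0 : ℝ) < k := Nat.cast_pos.2 hk
  have hk1 : (0 : ℝ) < (k : ℝ) + 1 := by positivity
  constructor
  · rintro ⟨hx, hnot⟩
    have hne : P.Nonempty := by
      by_contra! h
      simp [h] at hx
    rw [(D.convex.smul _).convexHull_union (D.convex.smul _) (hne.smul_set) (hne.smul_set),
      mem_convexJoin] at hx
    obtain ⟨u, hu, v, hv, a, b, ha, hb, hab, rfl⟩ := hx
    rw [D.mem_smul_iff hk0] at hu
    rw [D.mem_smul_iff hk1] at hv
    have hC : a • u + b • v ∈ cone P :=
      add_mem_cone (smul_mem_cone hu.2.2 ha) (smul_mem_cone hv.2.2 hb)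
    rw [Set.mem_union, not_or, D.mem_smul_iff hk0, D.mem_smul_iff hk1] at hnot
    have hf : ∀ f ∈ I, f (a • u + b • v) ≤ (k : ℝ) + 1 := by
      intro f hf
      simp only [map_add, map_smul, smul_eq_mul]
      nlinarith [mul_le_mul_of_nonneg_left (hu.1 f hf) ha,
        mul_le_mul_of_nonneg_left (hv.1 f hf) hb]
    have hg : ∀ g ∈ J, (k : ℝ) ≤ g (a • u + b • v) := by
      intro g hg
      simp only [map_add, map_smul, smul_eq_mul]
      nlinarith [mul_le_mul_of_nonneg_left (hu.2.1 g hg) ha,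
        mul_le_mul_of_nonneg_left (hv.2.1 g hg) hb]
    refine ⟨hC, ?_, ?_⟩
    · by_contra! h
      exact hnot.1 ⟨h, hg, hC⟩
    · by_contra! h
      exact hnot.2 ⟨hf, h, hC⟩
  · rintro ⟨hC, ⟨f₀, hf₀, h₀⟩, g₀, hg₀, h₁⟩
    have hx0 : x ≠ 0 := by
      rintro rfl
      rw [map_zero] at h₀
      linarith
    obtain ⟨f, hf, hf0, hmax⟩ := D.exists_max_far hC hx0
    have hkf : (k : ℝ) < f x := h₀.trans_le (hmax f₀ hf₀)
    have hfk : f x < (k : ℝ) + 1 := (D.le_of_mem_cone x hC f hf g₀ hg₀).trans_lt h₁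
    -- The dilate with factor the maximal far value contains `x`; this factor lies between k and k +
    -- 1, so `x` is on a radial segment of the hull.
    have hxf : x ∈ (f x) • P := (D.mem_smul_iff hf0 x).2
      ⟨hmax, fun g hg => D.le_of_mem_cone x hC f hf g hg, hC⟩
    obtain ⟨p, hp, hpx⟩ := hxf
    refine ⟨?_, ?_⟩
    · refine segment_subset_convexHull (x := (k : ℝ) • p) (y := ((k : ℝ) + 1) • p)
        (Or.inl (Set.smul_mem_smul_set hp)) (Or.inr (Set.smul_mem_smul_set hp)) ?_
      rw [segment_smul_smul (by linarith)]
      exact ⟨f x, hkf.le, hfk.le, hpx.symm⟩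
    · rw [Set.mem_union, not_or, D.mem_smul_iff hk0, D.mem_smul_iff hk1]
      exact ⟨fun h => absurd (h.1 f₀ hf₀) (not_le.2 h₀), fun h => absurd (h.2.1 g₀ hg₀) (not_le.2 h₁)⟩

/-- The set cut out by the closed versions of the inequalities defining `L P k`. -/
theorem closure_L_subset {k : ℕ} (hk : 0 < k) :
    closure (L P k) ⊆
      {x | x ∈ cone P ∧ (∃ f ∈ I, (k : ℝ) ≤ f x) ∧ ∃ g ∈ J, g x ≤ (k : ℝ) + 1} := by
  apply closure_minimal
  · intro x hx
    obtain ⟨h1, ⟨f, hf, h2⟩, g, hg, h3⟩ := (D.mem_L_iff hk x).1 hx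
    exact ⟨h1, ⟨f, hf, h2.le⟩, g, hg, h3.le⟩
  · have e : {x | x ∈ cone P ∧ (∃ f ∈ I, (k : ℝ) ≤ f x) ∧ ∃ g ∈ J, g x ≤ (k : ℝ) + 1} =
        cone P ∩ ((⋃ f ∈ I, {x | (k : ℝ) ≤ f x}) ∩ ⋃ g ∈ J, {x | g x ≤ (k : ℝ) + 1}) := by
      ext x
      simp only [Set.mem_ofPred_eq, Set.mem_inter_iff, Set.mem_iUnion, exists_prop]
    rw [e]
    refine D.isClosed_cone.inter (IsClosed.inter ?_ ?_)
    · exact I.finite_toSet.isClosed_biUnion fun f _ => isClosed_le continuous_const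
        (LinearMap.continuous_of_finiteDimensional f)
    · exact J.finite_toSet.isClosed_biUnion fun g _ => isClosed_le
        (LinearMap.continuous_of_finiteDimensional g) continuous_const

end RadialData

/-- Every edge of `P` joining two points of `W P` lies in the boundary of the cone. -/
def EdgesInFrontier (P : Set E3) : Prop :=
  ∀ A ∈ W P, ∀ B ∈ W P, Adjacent P A B → segment ℝ A B ⊆ frontier (cone P)

theorem mem_closure_of_eventually_add_smul {X : Set E3} {x d : E3}
    (h : ∀ᶠ s in nhdsWithin (0 : ℝ) (Set.Ioi 0), x + s • d ∈ X) : x ∈ closure X := by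
  have hc : Continuous fun s : ℝ => x + s • d := by fun_prop
  have ht : Filter.Tendsto (fun s : ℝ => x + s • d) (nhdsWithin 0 (Set.Ioi 0)) (nhds x) := by
    simpa using (hc.tendsto 0).mono_left (nhdsWithin_le_nhds (s := Set.Ioi 0))
  exact mem_closure_of_tendsto ht h

theorem finrank_ker_dual {h : Module.Dual ℝ E3} (h0 : h ≠ 0) :
    Module.finrank ℝ (LinearMap.ker h) = 2 := by
  have h1 := Module.Dual.finrank_ker_add_one_of_ne_zero h0
  rw [finrank_euclideanSpace_fin] at h1
  omega

/-! ### Edges and near faces with vertices in `W P` -/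

namespace RadialData

variable {P : Set E3} {I J H : Finset (Module.Dual ℝ E3)} (D : RadialData P I J H)
include D

theorem eventually_add_smul_mem_cone {x w : E3} (hx : x ∈ cone P)
    (hw : ∀ h ∈ H, h x = 0 → h w = 0) : ∀ᶠ s in nhds (0 : ℝ), x + s • w ∈ cone P := by
  have : ∀ᶠ s in nhds (0 : ℝ), ∀ h ∈ H, 0 ≤ h (x + s • w) := by
    rw [Filter.eventually_all_finset]
    intro h hh
    simp only [map_add, map_smul, smul_eq_mul]
    rcases ((D.mem_cone_iff x).1 hx h hh).eq_or_lt with h1 | h1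
    · exact Filter.Eventually.of_forall fun s => by rw [hw h hh h1.symm, ← h1]; simp
    · exact (eventually_lt_add_mul h1 _).mono fun s hs => hs.le
  exact this.mono fun s hs => (D.mem_cone_iff _).2 hs

theorem exists_edge_of_finrank_eq_one {y : E3} (hy : y ∈ P)
    (hdim : Module.finrank ℝ (activeKer (constraints I J H) y) = 1) :
    ∃ A B : E3, Adjacent P A B ∧ y ∈ openSegment ℝ A B ∧
      A - y ∈ activeKer (constraints I J H) y ∧ B - y ∈ activeKer (constraints I J H) y := by
  have e := D.eq_halfSpaces
  obtain ⟨A, B, hA, hB, hAB, hext, h⟩ := exists_edge (e ▸ hy)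
    (fun w hw => e ▸ exists_add_smul_notMem D.compact y hw) hdim
  rw [← e] at hA hB hext
  exact ⟨A, B, ⟨hA, hB, hAB, hext⟩, h⟩

theorem exists_vertex_mem_face {y : E3} (hy : y ∈ P) :
    ∃ A ∈ vertices P, A - y ∈ activeKer (constraints I J H) y := by
  have e := D.eq_halfSpaces
  induction hn : Module.finrank ℝ (activeKer (constraints I J H) y) using
    Nat.strong_induction_on generalizing y with
  | _ n ih =>
  by_cases hb : activeKer (constraints I J H) y = ⊥
  · exact ⟨y, (D.mem_vertices_iff hy).2 hb, by simp⟩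
  · obtain ⟨w, hw, hw0⟩ := Submodule.exists_mem_ne_zero_of_ne_bot hb
    obtain ⟨R, -, hout⟩ := exists_add_smul_notMem D.compact y hw0
    rw [e] at hout
    obtain ⟨t, -, -, ht, hlt⟩ := exists_exit (e ▸ hy) (Submodule.smul_mem _ R hw) hout
    rw [← e] at ht
    obtain ⟨A, hA, hAz⟩ := ih _ (hn ▸ Submodule.finrank_lt_finrank_of_lt hlt) ht rfl
    refine ⟨A, hA, ?_⟩
    have := Submodule.add_mem _ (hlt.le hAz) (Submodule.smul_mem _ t (Submodule.smul_mem _ R hw))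
    rwa [sub_add_eq_sub_sub, sub_add_cancel] at this

/-- If all vertices of a near face belong to `W P`, then this face meets every ray of the cone that
meets its affine hull. -/
theorem mem_of_near_face (hedge : EdgesInFrontier P) {y : E3} (hy : y ∈ P)
    (hlt : ∀ f ∈ I, f y < 1) (hnear : ∃ g ∈ J, g y = 1)
    (hW : ∀ A ∈ vertices P, A - y ∈ activeKer (constraints I J H) y → A ∈ W P)
    {a : E3} (ha : a ∈ cone P) (hay : a - y ∈ activeKer (constraints I J H) y) : a ∈ P := by
  by_contra hout
  have e := D.eq_halfSpaces
  have hyC := subset_cone P hy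
  -- Walking from `y` towards `a`, stop at the exit point z of the near face.
  obtain ⟨t, ht0, ht1, hz, hzlt⟩ := exists_exit (e ▸ hy) hay
    (by rw [add_sub_cancel, ← e]; exact hout)
  rw [← e] at hz
  obtain ⟨z, hzdef⟩ : ∃ z, z = y + t • (a - y) := ⟨_, rfl⟩
  rw [← hzdef] at hz hzlt
  have hval : ∀ l : Module.Dual ℝ E3, l z = (1 - t) * l y + t * l a := by
    intro l
    rw [hzdef]
    simp only [map_add, map_smul, map_sub, smul_eq_mul]
    ring
  have hzy : z - y ∈ activeKer (constraints I J H) y := by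
    rw [hzdef, add_sub_cancel_left]
    exact Submodule.smul_mem _ _ hay
  -- The gap between far and near functionals is strict at `y` and weak at `a`, hence strict at z.
  have hzW : z ∉ W P := by
    intro h
    obtain ⟨-, ⟨f, hf, h1⟩, g, hg, h2⟩ := D.mem_W_iff.1 h
    rw [hval] at h1 h2
    have h3 := hlt f hf
    have h4 := ((D.mem_iff_cone y).1 hy).2.1 g hg
    have h5 := D.le_of_mem_cone a ha f hf g hg
    nlinarith [mul_le_mul_of_nonneg_left h5 ht0.le,
      mul_lt_mul_of_pos_left (h3.trans_le h4) (sub_pos.2 ht1)]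
  have hzbot : activeKer (constraints I J H) z ≠ ⊥ := fun h =>
    hzW (hW z ((D.mem_vertices_iff hz).2 h) hzy)
  have h1 := Submodule.finrank_lt_finrank_of_lt hzlt
  -- The minimal face of the cone contains the radial direction, the near face does not. So the near
  -- face has dimension at most 2, and z, not being a vertex, lies inside an edge.
  have hS : activeKer (constraints I J H) y < activeKer (constraints ∅ ∅ H) y := by
    refine lt_of_le_of_ne (fun w hw => ?_) fun h => ?_
    · exact mem_activeKer_constraints.2
        ⟨by simp, by simp, (mem_activeKer_constraints.1 hw).2.2⟩
    · have : y ∈ activeKer (constraints ∅ ∅ H) y :=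
        mem_activeKer_constraints.2 ⟨by simp, by simp, fun _ _ h => h⟩
      rw [← h, mem_activeKer_constraints] at this
      obtain ⟨g, hg, hgy⟩ := hnear
      linarith [this.2.1 g hg hgy]
  have h2 := Submodule.finrank_lt_finrank_of_lt hS
  have h3 := Submodule.finrank_le (activeKer (constraints ∅ ∅ H) y)
  rw [finrank_euclideanSpace_fin] at h3
  have h4 : Module.finrank ℝ (activeKer (constraints I J H) z) ≠ 0 := fun h =>
    hzbot (Submodule.finrank_eq_zero.1 h)
  obtain ⟨A, B, hAB, hzAB, hA, hB⟩ := D.exists_edge_of_finrank_eq_one hz (by omega)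
  have hAW : A ∈ W P := hW A hAB.1 (by
    rw [← sub_add_sub_cancel A z y]; exact Submodule.add_mem _ (hzlt.le hA) hzy)
  have hBW : B ∈ W P := hW B hAB.2.1 (by
    rw [← sub_add_sub_cancel B z y]; exact Submodule.add_mem _ (hzlt.le hB) hzy)
  -- That edge lies in a supporting plane of the cone, which also contains `y` because z is strictly
  -- between `y` and `a`. Every dimension bound drops by one, leaving no room for the edge.
  obtain ⟨h, hh, hh0, hhz⟩ := D.exists_of_mem_frontier
    (hedge A hAW B hBW hAB (openSegment_subset_segment ℝ _ _ hzAB))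
  have hhy : h y = 0 := by
    rw [hval] at hhz
    have q1 := (D.mem_cone_iff y).1 hyC h hh
    have q2 := (D.mem_cone_iff a).1 ha h hh
    nlinarith [mul_nonneg ht0.le q2, mul_nonneg (sub_pos.2 ht1).le q1]
  have hker : activeKer (constraints ∅ ∅ H) y ≤ LinearMap.ker h := fun w hw =>
    (mem_activeKer_constraints.1 hw).2.2 h hh hhy
  have h5 := Submodule.finrank_mono hker
  rw [finrank_ker_dual hh0] at h5
  omega

/-! ### The threshold -/

/-- Only finitely many strict inequalities f Q < 1 and g Q > 1 are involved, and (k + 1) / k tends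
to 1. -/
theorem exists_mem_thresholds : ∃ κ, κ ∈ thresholds P := by
  have h1 : ∀ᶠ k : ℕ in Filter.atTop, ∀ Q ∈ vertices P, ∀ f ∈ I, f Q < 1 →
      ((k : ℝ) + 1) * f Q < k := by
    rw [Filter.eventually_all_finite D.finite_vertices]
    intro Q _
    rw [Filter.eventually_all_finset]
    intro f _
    filter_upwards [tendsto_natCast_atTop_atTop.eventually_gt_atTop (f Q / (1 - f Q))]
      with k hk hlt
    rw [div_lt_iff₀ (by linarith)] at hk
    linarith
  have h2 : ∀ᶠ k : ℕ in Filter.atTop, ∀ Q ∈ vertices P, ∀ g ∈ J, 1 < g Q →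
      (k : ℝ) + 1 < k * g Q := by
    rw [Filter.eventually_all_finite D.finite_vertices]
    intro Q _
    rw [Filter.eventually_all_finset]
    intro g _
    filter_upwards [tendsto_natCast_atTop_atTop.eventually_gt_atTop (1 / (g Q - 1))]
      with k hk hlt
    rw [div_lt_iff₀ (by linarith)] at hk
    linarith
  obtain ⟨κ, hκ⟩ := Filter.eventually_atTop.1
    ((h1.and h2).and (Filter.eventually_gt_atTop 0))
  refine ⟨κ, fun k hk => ?_⟩
  obtain ⟨⟨h1, h2⟩, h0⟩ := hκ k hk
  have hk0 : (0 : ℝ) < k := Nat.cast_pos.2 h0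
  constructor
  · intro Q hQ
    obtain ⟨hQ, hlt⟩ := D.mem_near_iff.1 hQ
    obtain ⟨-, q2, q3⟩ := (D.mem_iff_cone Q).1 hQ.1
    rw [D.mem_relInterior_smul_iff hk0]
    simp only [map_smul, smul_eq_mul]
    exact ⟨smul_mem_cone q3 (by positivity), fun f hf => h1 Q hQ f hf (hlt f hf),
      fun g hg => by nlinarith [q2 g hg]⟩
  · intro Q hQ
    obtain ⟨hQ, hlt⟩ := D.mem_far_iff.1 hQ
    obtain ⟨q1, -, q3⟩ := (D.mem_iff_cone Q).1 hQ.1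
    rw [D.mem_relInterior_smul_iff (by positivity)]
    simp only [map_smul, smul_eq_mul]
    exact ⟨smul_mem_cone q3 hk0.le, fun f hf => by nlinarith [q1 f hf],
      fun g hg => h2 Q hQ g hg (hlt g hg)⟩

/-- Some vertex of a solid polytope lies outside `W P`. -/
theorem exists_vertex_notMem_W (hedge : EdgesInFrontier P) (hint : (interior P).Nonempty) :
    ∃ A ∈ vertices P, A ∉ W P := by
  by_contra! hW
  obtain ⟨p, hp⟩ := hint
  have hpP := interior_subset hp
  have hpC := subset_cone P hpP
  have hp0 := D.ne_zero_of_mem hpP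
  have hdir : ∀ v : E3, ∀ᶠ s in nhds (0 : ℝ), p + s • v ∈ P := by
    intro v
    have hc : Continuous fun s : ℝ => p + s • v := by fun_prop
    have : ∀ᶠ z in nhds (p + (0 : ℝ) • v), z ∈ P := by
      simpa using mem_interior_iff_mem_nhds.1 hp
    exact (hc.tendsto 0).eventually this
  obtain ⟨g, hg, hgmin⟩ := D.exists_min_near p
  have hg0 := D.pos_near hpC hp0 hg
  have hg1 : 1 < g p := by
    obtain ⟨s, hs, -, h⟩ := exists_pos_lt_of_eventually (hdir (-p)) one_pos
    have := ((D.mem_iff_cone _).1 h).2.1 g hg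
    simp only [map_add, map_smul, map_neg, smul_eq_mul] at this
    nlinarith
  have hH : ∀ h ∈ H, h p = 0 → h = 0 := by
    intro h hh hhp
    have hnn : ∀ v, 0 ≤ h v := by
      intro v
      obtain ⟨s, hs, -, hsP⟩ := exists_pos_lt_of_eventually (hdir v) one_pos
      have := ((D.mem_iff _).1 hsP).2.2 h hh
      rw [map_add, hhp, zero_add, map_smul, smul_eq_mul] at this
      exact nonneg_of_mul_nonneg_right this hs
    ext v
    have h2 := hnn (-v)
    rw [map_neg] at h2
    rw [LinearMap.zero_apply]
    linarith [hnn v]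
  -- Pushed radially onto the near surface, `p` becomes a point whose far values are strictly below
  -- 1.
  have hyf : ∀ f ∈ I, f ((g p)⁻¹ • p) < 1 := by
    intro f hf
    rw [map_smul, smul_eq_mul, inv_mul_lt_iff₀ hg0, mul_one]
    exact (((D.mem_iff p).1 hpP).1 f hf).trans_lt hg1
  have hgy : g ((g p)⁻¹ • p) = 1 := by rw [map_smul, smul_eq_mul, inv_mul_cancel₀ hg0.ne']
  have hyP : (g p)⁻¹ • p ∈ P := by
    refine (D.mem_iff_cone _).2 ⟨fun f hf => (hyf f hf).le, fun g' hg' => ?_,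
      smul_mem_cone hpC (inv_pos.2 hg0).le⟩
    rw [map_smul, smul_eq_mul, le_inv_mul_iff₀ hg0, mul_one]
    exact hgmin g' hg'
  have hHy : ∀ h ∈ H, h ((g p)⁻¹ • p) = 0 → h = 0 := by
    intro h hh h1
    rw [map_smul, smul_eq_mul] at h1
    exact hH h hh ((mul_eq_zero.1 h1).resolve_left (inv_pos.2 hg0).ne')
  generalize (g p)⁻¹ • p = y at hyf hgy hyP hHy
  have hgne : g ≠ 0 := by
    rintro rfl
    simp at hg0
  have hle : activeKer (constraints I J H) y ≤ LinearMap.ker g := fun w hw =>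
    (mem_activeKer_constraints.1 hw).2.1 g hg hgy
  have hfr := Submodule.finrank_mono hle
  rw [finrank_ker_dual hgne] at hfr
  -- The near face below `p` is two-dimensional: a vertex would lie in `W P` and have a far value 1,
  -- and an edge with ends in `W P` would lie in a supporting plane of the cone.
  have hfr0 : Module.finrank ℝ (activeKer (constraints I J H) y) ≠ 0 := by
    intro h
    obtain ⟨-, ⟨f, hf, h1⟩, -⟩ := D.mem_W_iff.1
      (hW y ((D.mem_vertices_iff hyP).2 (Submodule.finrank_eq_zero.1 h)))
    exact (hyf f hf).ne h1
  have hfr1 : Module.finrank ℝ (activeKer (constraints I J H) y) ≠ 1 := by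
    intro h
    obtain ⟨A, B, hAB, hy, -⟩ := D.exists_edge_of_finrank_eq_one hyP h
    obtain ⟨l, hl, hl0, hly⟩ := D.exists_of_mem_frontier
      (hedge A (hW A hAB.1) B (hW B hAB.2.1) hAB (openSegment_subset_segment ℝ _ _ hy))
    exact hl0 (hHy l hl hly)
  have heq : activeKer (constraints I J H) y = LinearMap.ker g :=
    Submodule.eq_of_le_of_finrank_eq hle (by rw [finrank_ker_dual hgne]; omega)
  -- Every vertex can be rescaled into the plane of this face and still lie in `P`; for a vertex in
  -- `W P` the factor must be 1. So `P` would be confined to g ≤ 1, although g p > 1.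
  have hgA : ∀ A ∈ vertices P, g A = 1 := by
    intro A hA
    have hAC := subset_cone P hA.1
    have hgA0 := D.pos_near hAC (D.ne_zero_of_mem hA.1) hg
    have ha : (g A)⁻¹ • A ∈ P := by
      refine D.mem_of_near_face hedge hyP hyf ⟨g, hg, hgy⟩ (fun A hA _ => hW A hA)
        (smul_mem_cone hAC (inv_pos.2 hgA0).le) ?_
      rw [heq, LinearMap.mem_ker, map_sub, map_smul, smul_eq_mul, inv_mul_cancel₀ hgA0.ne', hgy,
        sub_self]
    have := congrArg g (D.eq_of_mem_W_of_smul_mem (hW A hA) ha)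
    rw [map_smul, smul_eq_mul, inv_mul_cancel₀ hgA0.ne'] at this
    exact this.symm
  have hsub : P ⊆ {x | g x ≤ 1} := by
    rw [← closure_convexHull_extremePoints D.compact D.convex]
    refine closure_minimal (convexHull_min (fun A hA => (hgA A hA).le)
      (convex_halfSpace_le g.isLinear 1))
      (isClosed_le (LinearMap.continuous_of_finiteDimensional g) continuous_const)
  exact (hsub hpP).not_gt hg1

/-- For k = 0 the threshold conditions say that near vertices are 0 and, if there are far ones, that
`0 ∈ P`; a vertex outside `W P` makes this absurd. -/
theorem zero_notMem_thresholds (hedge : EdgesInFrontier P) (hint : (interior P).Nonempty) :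
    0 ∉ thresholds P := by
  intro h
  obtain ⟨A, hA, hAW⟩ := D.exists_vertex_notMem_W hedge hint
  have hne : P.Nonempty := ⟨A, hA.1⟩
  have hmem : ∀ {x : E3} {X : Set E3}, x ∈ relInterior (cone P) X → x ∈ X := by
    intro x X hx
    obtain ⟨h1, h2⟩ := mem_relInterior.1 hx
    exact mem_of_mem_nhdsWithin h1 h2
  obtain ⟨h1, h2⟩ := h 0 le_rfl
  rcases (D.vertex_cases hA).resolve_left hAW with hA' | hA'
  · have := hmem (h1 A hA')
    rw [Nat.cast_zero, Set.zero_smul_set hne, zero_add, one_smul] at this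
    exact D.ne_zero_of_mem hA.1 this
  · have := hmem (h2 A hA')
    rw [Nat.cast_zero, zero_add, one_smul, zero_smul] at this
    exact D.zero_notMem this

theorem lt_of_mem_near {k : ℕ} (hk : 0 < k) (hT : k ∈ thresholds P) {Q : E3}
    (hQ : Q ∈ V₁ P ∪ W₁ P) {f : Module.Dual ℝ E3} (hf : f ∈ I) : ((k : ℝ) + 1) * f Q < k := by
  have := ((D.mem_relInterior_smul_iff (Nat.cast_pos.2 hk) _).1 ((hT k le_rfl).1 Q hQ)).2.1 f hf
  rwa [map_smul, smul_eq_mul] at this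

theorem lt_of_mem_far {k : ℕ} (hT : k ∈ thresholds P) {Q : E3}
    (hQ : Q ∈ V₂ P ∪ W₂ P) {g : Module.Dual ℝ E3} (hg : g ∈ J) : (k : ℝ) + 1 < k * g Q := by
  have := ((D.mem_relInterior_smul_iff (by positivity) _).1 ((hT k le_rfl).2 Q hQ)).2.2 g hg
  rwa [map_smul, smul_eq_mul] at this

end RadialData

theorem eventually_add_smul_self_mem_cone {P : Set E3} {x c : E3} (hx : x ∈ cone P) (hc : c ∈ cone P) (r : ℝ) :
    ∀ᶠ s in nhds (0 : ℝ), 0 < s → x + s • (c + r • x) ∈ cone P := by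
  filter_upwards [eventually_lt_add_mul (show (0 : ℝ) < 1 by norm_num) r] with s hs hs0
  have : x + s • (c + r • x) = s • c + (1 + s * r) • x := by
    rw [smul_add, smul_smul, add_smul, one_smul]; abel
  rw [this]
  exact add_mem_cone (smul_mem_cone hc hs0.le) (smul_mem_cone hx hs.le)

namespace RadialData

variable {P : Set E3} {I J H : Finset (Module.Dual ℝ E3)} (D : RadialData P I J H)
include D

/-! ### The closure of `L P k` -/

theorem mem_closure_L_of_direction {k : ℕ} (hk : 0 < k) {x d : E3}
    (hC : ∀ᶠ s in nhds (0 : ℝ), 0 < s → x + s • d ∈ cone P)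
    (hf : ∃ f ∈ I, (k : ℝ) < f x ∨ (k : ℝ) ≤ f x ∧ 0 < f d)
    (hg : ∃ g ∈ J, g x < (k : ℝ) + 1 ∨ g x ≤ (k : ℝ) + 1 ∧ g d < 0) : x ∈ closure (L P k) := by
  obtain ⟨f, hf, hfx⟩ := hf
  obtain ⟨g, hg, hgx⟩ := hg
  have h1 : ∀ᶠ s in nhds (0 : ℝ), 0 < s → (k : ℝ) < f x + s * f d := by
    rcases hfx with h | ⟨h, h'⟩
    · exact (eventually_lt_add_mul h _).mono fun s hs _ => hs
    · exact Filter.Eventually.of_forall fun s hs => by nlinarith [mul_pos hs h']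
  have h2 : ∀ᶠ s in nhds (0 : ℝ), 0 < s → g x + s * g d < (k : ℝ) + 1 := by
    rcases hgx with h | ⟨h, h'⟩
    · exact (eventually_add_mul_lt h _).mono fun s hs _ => hs
    · exact Filter.Eventually.of_forall fun s hs => by nlinarith [mul_pos hs (neg_pos.2 h')]
  apply mem_closure_of_eventually_add_smul (d := d)
  filter_upwards [nhdsWithin_le_nhds hC, nhdsWithin_le_nhds h1, nhdsWithin_le_nhds h2,
    self_mem_nhdsWithin] with s q0 q1 q2 hs
  rw [D.mem_L_iff hk]
  exact ⟨q0 hs, ⟨f, hf, by simpa using q1 hs⟩, g, hg, by simpa using q2 hs⟩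

/-- If one surface is slack at `x`, a small radial move enters `L P k`. If both are tight, some cone
direction must raise a far functional while lowering a near one; otherwise active far and near
functionals are proportional along the minimal face of the cone, which contradicts the threshold and
the edge hypothesis. -/
theorem mem_closure_L {k : ℕ} (hk : 0 < k) (hT : k ∈ thresholds P) (hedge : EdgesInFrontier P)
    {x : E3} (hx : x ∈ cone P) (hf : ∃ f ∈ I, (k : ℝ) ≤ f x) (hg : ∃ g ∈ J, g x ≤ (k : ℝ) + 1) :
    x ∈ closure (L P k) := by
  have hk0 : (0 : ℝ) < k := Nat.cast_pos.2 hk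
  have hk1 : (0 : ℝ) < (k : ℝ) + 1 := by positivity
  obtain ⟨f₀, hf₀, hfx⟩ := hf
  obtain ⟨g₀, hg₀, hgx⟩ := hg
  have hx0 : x ≠ 0 := by
    rintro rfl
    rw [map_zero] at hfx
    linarith
  have hg₀x := D.pos_near hx hx0 hg₀
  by_cases hA : ∃ f ∈ I, (k : ℝ) < f x
  · obtain ⟨f, hf, hfk⟩ := hA
    refine D.mem_closure_L_of_direction hk (d := 0 + (-1 : ℝ) • x)
      (eventually_add_smul_self_mem_cone hx (PointedCone.hull ℝ P).zero_mem _) ⟨f, hf, Or.inl hfk⟩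
      ⟨g₀, hg₀, Or.inr ⟨hgx, by simpa using hg₀x⟩⟩
  by_cases hB : ∃ g ∈ J, g x < (k : ℝ) + 1
  · obtain ⟨g, hg, hgk⟩ := hB
    refine D.mem_closure_L_of_direction hk (d := 0 + (1 : ℝ) • x)
      (eventually_add_smul_self_mem_cone hx (PointedCone.hull ℝ P).zero_mem _)
      ⟨f₀, hf₀, Or.inr ⟨hfx, by simpa using hk0.trans_le hfx⟩⟩ ⟨g, hg, Or.inl hgk⟩
  push Not at hA hB
  by_contra hcl
  -- If the inequality failed at `c`, subtracting a suitable multiple of `x` would make f increase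
  -- and g decrease.
  have claim : ∀ f ∈ I, f x = k → ∀ g ∈ J, g x = (k : ℝ) + 1 → ∀ c ∈ cone P,
      ((k : ℝ) + 1) * f c ≤ k * g c := by
    intro f hf hfx g hg hgx c hc
    by_contra! hlt
    have hdiv : g c / ((k : ℝ) + 1) < f c / k := by
      rw [div_lt_div_iff₀ hk1 hk0]; linarith
    obtain ⟨r, hr1, hr2⟩ := exists_between hdiv
    rw [div_lt_iff₀ hk1] at hr1
    rw [lt_div_iff₀ hk0] at hr2
    refine hcl (D.mem_closure_L_of_direction hk (d := c + (-r) • x)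
      (eventually_add_smul_self_mem_cone hx hc _) ⟨f, hf, Or.inr ⟨hfx.ge, ?_⟩⟩
      ⟨g, hg, Or.inr ⟨hgx.le, ?_⟩⟩)
    · rw [map_add, map_smul, smul_eq_mul, hfx]; linarith
    · rw [map_add, map_smul, smul_eq_mul, hgx]; linarith
  -- Both `w` and `-w` are admissible at `x`, so the inequality becomes an equality.
  have claim' : ∀ f ∈ I, f x = k → ∀ g ∈ J, g x = (k : ℝ) + 1 → ∀ w : E3,
      (∀ h ∈ H, h x = 0 → h w = 0) → ((k : ℝ) + 1) * f w = k * g w := by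
    have half : ∀ f ∈ I, f x = k → ∀ g ∈ J, g x = (k : ℝ) + 1 → ∀ w : E3,
        (∀ h ∈ H, h x = 0 → h w = 0) → ((k : ℝ) + 1) * f w ≤ k * g w := by
      intro f hf hfx g hg hgx w hw
      obtain ⟨s, hs, -, hsC⟩ :=
        exists_pos_lt_of_eventually (D.eventually_add_smul_mem_cone hx hw) one_pos
      have := claim f hf hfx g hg hgx _ hsC
      simp only [map_add, map_smul, smul_eq_mul, hfx, hgx] at this
      have h2 : s * (((k : ℝ) + 1) * f w) ≤ s * (k * g w) := by linarith
      exact le_of_mul_le_mul_left h2 hs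
    intro f hf hfx g hg hgx w hw
    have h1 := half f hf hfx g hg hgx w hw
    have h2 := half f hf hfx g hg hgx (-w) fun h hh h0 => by rw [map_neg, hw h hh h0, neg_zero]
    simp only [map_neg] at h2
    linarith
  have hf₀x : f₀ x = k := le_antisymm (hA f₀ hf₀) hfx
  have hg₀x : g₀ x = (k : ℝ) + 1 := le_antisymm hgx (hB g₀ hg₀)
  have hval : ∀ (l : Module.Dual ℝ E3) (t : ℝ), l (t⁻¹ • x) = l x / t := fun l t => by
    rw [map_smul, smul_eq_mul, div_eq_inv_mul]
  have hyP : ((k : ℝ) + 1)⁻¹ • x ∈ P := by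
    rw [← Set.mem_smul_set_iff_inv_smul_mem₀ hk1.ne', D.mem_smul_iff hk1]
    exact ⟨fun f hf => (hA f hf).trans (by linarith), hB, hx⟩
  have hyP' : (k : ℝ)⁻¹ • x ∈ P := by
    rw [← Set.mem_smul_set_iff_inv_smul_mem₀ hk0.ne', D.mem_smul_iff hk0]
    exact ⟨hA, fun g hg => le_trans (by linarith) (hB g hg), hx⟩
  obtain ⟨y, hy⟩ : ∃ y, y = ((k : ℝ) + 1)⁻¹ • x := ⟨_, rfl⟩
  obtain ⟨y', hy'⟩ : ∃ y', y' = (k : ℝ)⁻¹ • x := ⟨_, rfl⟩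
  have hvy : ∀ l : Module.Dual ℝ E3, l y = l x / ((k : ℝ) + 1) := fun l => by rw [hy, hval]
  have hvy' : ∀ l : Module.Dual ℝ E3, l y' = l x / (k : ℝ) := fun l => by rw [hy', hval]
  rw [← hy] at hyP
  rw [← hy'] at hyP'
  have hlt : ∀ f ∈ I, f y < 1 := by
    intro f hf
    rw [hvy, div_lt_one hk1]
    linarith [hA f hf]
  have hfarv : ∀ A, A - y' ∈ activeKer (constraints I J H) y' → f₀ A = 1 ∧
      ∀ h ∈ H, h x = 0 → h A = 0 := by
    intro A hA
    rw [mem_activeKer_constraints] at hA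
    constructor
    · have := hA.1 f₀ hf₀ (by rw [hvy', hf₀x, div_self hk0.ne'])
      rw [map_sub, hvy', hf₀x, div_self hk0.ne'] at this
      linarith
    · intro h hh h0
      have := hA.2.2 h hh (by rw [hvy', h0, zero_div])
      rw [map_sub, hvy', h0, zero_div] at this
      linarith
  have hnearv : ∀ A, A - y ∈ activeKer (constraints I J H) y → g₀ A = 1 ∧
      ∀ h ∈ H, h x = 0 → h A = 0 := by
    intro A hA
    rw [mem_activeKer_constraints] at hA
    constructor
    · have := hA.2.1 g₀ hg₀ (by rw [hvy, hg₀x, div_self hk1.ne'])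
      rw [map_sub, hvy, hg₀x, div_self hk1.ne'] at this
      linarith
    · intro h hh h0
      have := hA.2.2 h hh (by rw [hvy, h0, zero_div])
      rw [map_sub, hvy, h0, zero_div] at this
      linarith
  -- On the near face g₀ = 1 and (k + 1) f₀ = k, whereas near vertices have (k + 1) f₀ < k and far
  -- ones k g₀ > k + 1.
  have hW : ∀ A ∈ vertices P, A - y ∈ activeKer (constraints I J H) y → A ∈ W P := by
    intro A hA hAy
    obtain ⟨h1, h2⟩ := hnearv A hAy
    have h3 := claim' f₀ hf₀ hf₀x g₀ hg₀ hg₀x A h2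
    rw [h1] at h3
    rcases D.vertex_cases hA with h | h | h
    · exact h
    · linarith [D.lt_of_mem_near hk hT h hf₀]
    · have := D.lt_of_mem_far hT h hg₀
      rw [h1] at this
      linarith
  obtain ⟨A, hAv, hAy⟩ := D.exists_vertex_mem_face hyP'
  obtain ⟨h1, h2⟩ := hfarv A hAy
  have h3 := claim' f₀ hf₀ hf₀x g₀ hg₀ hg₀x A h2
  rw [h1] at h3
  have hAW : A ∈ W P := by
    rcases D.vertex_cases hAv with h | h | h
    · exact h
    · have := D.lt_of_mem_near hk hT h hf₀
      rw [h1] at this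
      linarith
    · linarith [D.lt_of_mem_far hT h hg₀]
  -- By proportionality every near functional active at `x` equals (k + 1) / k at the far vertex
  -- `A`, so this multiple lies in the affine hull of the near face, hence in `P`; but the ray of
  -- `A` meets `P` only at `A`.
  have ha : ((k : ℝ) / (k + 1)) • A ∈ P := by
    refine D.mem_of_near_face hedge hyP hlt ⟨g₀, hg₀, by rw [hvy, hg₀x, div_self hk1.ne']⟩ hW
      (smul_mem_cone (subset_cone P hAv.1) (by positivity)) ?_
    rw [mem_activeKer_constraints]
    refine ⟨fun f hf h => absurd h (hlt f hf).ne, fun g hg h => ?_, fun h hh h0 => ?_⟩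
    · have hgx' : g x = (k : ℝ) + 1 := by
        rw [hvy, div_eq_one_iff_eq hk1.ne'] at h
        exact h
      have := claim' f₀ hf₀ hf₀x g hg hgx' A h2
      rw [h1] at this
      rw [map_sub, h, map_smul, smul_eq_mul, div_mul_eq_mul_div, ← this, mul_one,
        div_self hk1.ne', sub_self]
    · have hhx : h x = 0 := by
        rw [hvy, div_eq_zero_iff] at h0
        exact h0.resolve_right hk1.ne'
      rw [map_sub, h0, map_smul, h2 h hh hhx, smul_zero, sub_zero]
  have := congrArg f₀ (D.eq_of_mem_W_of_smul_mem hAW ha)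
  rw [map_smul, h1, smul_eq_mul, mul_one, div_eq_one_iff_eq hk1.ne'] at this
  linarith

theorem mem_closure_L_iff {k : ℕ} (hk : 0 < k) (hT : k ∈ thresholds P)
    (hedge : EdgesInFrontier P) (x : E3) :
    x ∈ closure (L P k) ↔
      x ∈ cone P ∧ (∃ f ∈ I, (k : ℝ) ≤ f x) ∧ ∃ g ∈ J, g x ≤ (k : ℝ) + 1 :=
  ⟨fun h => D.closure_L_subset hk h, fun ⟨h1, h2, h3⟩ => D.mem_closure_L hk hT hedge h1 h2 h3⟩

end RadialData

/-! ### Local invariance of polyhedral sets -/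

/-- A disjunction with a slack member holds throughout a neighbourhood and imposes nothing on `w`.
Any remaining inequality has constant truth value near `x`, or its functional is constant along `w`.
-/
theorem locallyInvariantAlong_of_forall {I J H : Finset (Module.Dual ℝ E3)} {α β : ℝ}
    {X : Set E3} (hX : ∀ z, z ∈ X ↔ (∃ f ∈ I, α ≤ f z) ∧ (∃ g ∈ J, g z ≤ β) ∧ ∀ h ∈ H, 0 ≤ h z)
    {x w : E3} (hf : (∃ f ∈ I, α < f x) ∨ ∀ f ∈ I, f x = α → f w = 0)
    (hg : (∃ g ∈ J, g x < β) ∨ ∀ g ∈ J, g x = β → g w = 0)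
    (hh : ∀ h ∈ H, h x = 0 → h w = 0) : LocallyInvariantAlong X x w := by
  have hcont : ∀ l : Module.Dual ℝ E3, Continuous l := fun l =>
    LinearMap.continuous_of_finiteDimensional l
  have key : ∀ (l : Module.Dual ℝ E3) (c : ℝ), (l x = c → l w = 0) →
      ∀ᶠ q : E3 × E3 in nhds (x, x), (∃ t : ℝ, q.2 = q.1 + t • w) →
        ((c ≤ l q.1 ↔ c ≤ l q.2) ∧ (l q.1 ≤ c ↔ l q.2 ≤ c)) := by
    intro l c hl
    have h1 := ((hcont l).comp continuous_fst).tendsto (x, x)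
    have h2 := ((hcont l).comp continuous_snd).tendsto (x, x)
    rcases lt_trichotomy (l x) c with h | h | h
    · filter_upwards [h1.eventually (gt_mem_nhds h), h2.eventually (gt_mem_nhds h)] with q q1 q2 _
      simp only [Function.comp_apply] at q1 q2
      constructor <;> constructor <;> intro <;> linarith
    · refine Filter.Eventually.of_forall ?_
      rintro q ⟨t, hq⟩
      simp [hq, hl h]
    · filter_upwards [h1.eventually (lt_mem_nhds h), h2.eventually (lt_mem_nhds h)] with q q1 q2 _
      simp only [Function.comp_apply] at q1 q2
      constructor <;> constructor <;> intro <;> linarith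
  have hfe : ∀ᶠ q : E3 × E3 in nhds (x, x), (∃ t : ℝ, q.2 = q.1 + t • w) →
      ((∃ f ∈ I, α ≤ f q.1) ↔ ∃ f ∈ I, α ≤ f q.2) := by
    rcases hf with ⟨f, hf, h⟩ | hf
    · filter_upwards [(((hcont f).comp continuous_fst).tendsto (x, x)).eventually (lt_mem_nhds h),
        (((hcont f).comp continuous_snd).tendsto (x, x)).eventually (lt_mem_nhds h)] with q q1 q2 _
      exact ⟨fun _ => ⟨f, hf, q2.le⟩, fun _ => ⟨f, hf, q1.le⟩⟩
    · have : ∀ᶠ q : E3 × E3 in nhds (x, x), ∀ f ∈ I, (∃ t : ℝ, q.2 = q.1 + t • w) →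
          ((α ≤ f q.1 ↔ α ≤ f q.2) ∧ (f q.1 ≤ α ↔ f q.2 ≤ α)) :=
        (Filter.eventually_all_finset I).2 fun f hfI => key f α (hf f hfI)
      filter_upwards [this] with q hq ht
      exact exists_congr fun f => and_congr_right fun hf => (hq f hf ht).1
  have hge : ∀ᶠ q : E3 × E3 in nhds (x, x), (∃ t : ℝ, q.2 = q.1 + t • w) →
      ((∃ g ∈ J, g q.1 ≤ β) ↔ ∃ g ∈ J, g q.2 ≤ β) := by
    rcases hg with ⟨g, hg, h⟩ | hg
    · filter_upwards [(((hcont g).comp continuous_fst).tendsto (x, x)).eventually (gt_mem_nhds h),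
        (((hcont g).comp continuous_snd).tendsto (x, x)).eventually (gt_mem_nhds h)] with q q1 q2 _
      exact ⟨fun _ => ⟨g, hg, q2.le⟩, fun _ => ⟨g, hg, q1.le⟩⟩
    · have : ∀ᶠ q : E3 × E3 in nhds (x, x), ∀ g ∈ J, (∃ t : ℝ, q.2 = q.1 + t • w) →
          ((β ≤ g q.1 ↔ β ≤ g q.2) ∧ (g q.1 ≤ β ↔ g q.2 ≤ β)) :=
        (Filter.eventually_all_finset J).2 fun g hgJ => key g β (hg g hgJ)
      filter_upwards [this] with q hq ht
      exact exists_congr fun g => and_congr_right fun hg => (hq g hg ht).2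
  have hhe : ∀ᶠ q : E3 × E3 in nhds (x, x), ∀ h ∈ H, (∃ t : ℝ, q.2 = q.1 + t • w) →
      ((0 ≤ h q.1 ↔ 0 ≤ h q.2) ∧ (h q.1 ≤ 0 ↔ h q.2 ≤ 0)) :=
    (Filter.eventually_all_finset H).2 fun h hhH => key h 0 (hh h hhH)
  obtain ⟨ε, hε, hball⟩ := Metric.eventually_nhds_iff_ball.1 ((hfe.and hge).and hhe)
  refine ⟨ε, hε, fun y hy t hyt => ?_⟩
  obtain ⟨⟨h1, h2⟩, h3⟩ := hball (y, y + t • w) (by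
    rw [← ball_prod_same]; exact ⟨hy, hyt⟩)
  rw [hX, hX, h1 ⟨t, rfl⟩, h2 ⟨t, rfl⟩]
  exact and_congr_right fun _ => and_congr_right fun _ =>
    forall₂_congr fun h hh => (h3 h hh ⟨t, rfl⟩).1

theorem LocallyInvariantAlong.eventually_iff {X : Set E3} {x w : E3}
    (h : LocallyInvariantAlong X x w) (d : E3) (t : ℝ) :
    ∀ᶠ s in nhds (0 : ℝ), (x + s • d ∈ X ↔ x + s • (d + t • w) ∈ X) := by
  obtain ⟨ε, hε, h⟩ := h
  have hlim : ∀ v : E3, ∀ᶠ s in nhds (0 : ℝ), x + s • v ∈ Metric.ball x ε := by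
    intro v
    have hc : Continuous fun s : ℝ => x + s • v := by fun_prop
    have : ∀ᶠ z in nhds (x + (0 : ℝ) • v), z ∈ Metric.ball x ε := by
      rw [zero_smul, add_zero]
      exact Metric.ball_mem_nhds x hε
    exact (hc.tendsto 0).eventually this
  filter_upwards [hlim d, hlim (d + t • w)] with s h1 h2
  have e : x + s • (d + t • w) = x + s • d + (s * t) • w := by
    rw [smul_add, smul_smul, add_assoc]
  rw [e] at h2 ⊢
  exact h _ h1 _ h2

/-! ### Obstructions to local invariance; both disjunctions are written with ≥, so that their roles
can be exchanged -/

section Polyhedral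

variable {U V H : Finset (Module.Dual ℝ E3)} {α β : ℝ} {X : Set E3}
  (hX : ∀ z, z ∈ X ↔ (∃ u ∈ U, α ≤ u z) ∧ (∃ v ∈ V, β ≤ v z) ∧ ∀ h ∈ H, 0 ≤ h z)
  {x w : E3}
include hX

/-- Since `x` itself is in `X`, so are nearby points on both sides along `w`; a functional vanishing
at `x` cannot change sign there. -/
theorem LocallyInvariantAlong.eq_zero_of_boundary (hinv : LocallyInvariantAlong X x w)
    (hx : x ∈ X) {h : Module.Dual ℝ E3} (hh : h ∈ H) (hhx : h x = 0) : h w = 0 := by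
  have half : ∀ t : ℝ, 0 ≤ t * h w := by
    intro t
    obtain ⟨s, hs, -, hsX⟩ := exists_pos_lt_of_eventually (hinv.eventually_iff 0 t) one_pos
    rw [smul_zero, add_zero] at hsX
    have := ((hX _).1 (hsX.1 hx)).2.2 h hh
    simp only [map_add, map_smul, smul_eq_mul, hhx, zero_add] at this
    exact nonneg_of_mul_nonneg_right this hs
  have h1 := half 1
  have h2 := half (-1)
  linarith

theorem eventually_notMem_of_neg {d : E3} (hU : ∀ u ∈ U, u x ≤ α)
    (hd : ∀ u ∈ U, u x = α → u d < 0) : ∀ᶠ s in nhds (0 : ℝ), 0 < s → x + s • d ∉ X := by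
  have : ∀ᶠ s in nhds (0 : ℝ), ∀ u ∈ U, 0 < s → u (x + s • d) < α := by
    rw [Filter.eventually_all_finset]
    intro u hu
    simp only [map_add, map_smul, smul_eq_mul]
    rcases (hU u hu).eq_or_lt with h | h
    · exact Filter.Eventually.of_forall fun s hs => by nlinarith [mul_pos hs (neg_pos.2 (hd u hu h))]
    · exact (eventually_add_mul_lt h _).mono fun s hs _ => hs
  filter_upwards [this] with s hs hs0 hmem
  obtain ⟨u, hu, h⟩ := ((hX _).1 hmem).1
  exact absurd h (not_le.2 (hs u hu hs0))

theorem eventually_mem_of_nonneg {d : E3} (hx : x ∈ X)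
    (hd : ∀ h ∈ H, h x = 0 → h d = 0) (hu : ∃ u ∈ U, α < u x ∨ α ≤ u x ∧ 0 ≤ u d)
    (hv : ∃ v ∈ V, β < v x ∨ β ≤ v x ∧ 0 ≤ v d) :
    ∀ᶠ s in nhds (0 : ℝ), 0 < s → x + s • d ∈ X := by
  have lin : ∀ (c : ℝ) (l : Module.Dual ℝ E3), (c < l x ∨ c ≤ l x ∧ 0 ≤ l d) →
      ∀ᶠ s in nhds (0 : ℝ), 0 < s → c ≤ l (x + s • d) := by
    intro c l h
    simp only [map_add, map_smul, smul_eq_mul]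
    rcases h with h | ⟨h, h'⟩
    · exact (eventually_lt_add_mul h _).mono fun s hs _ => hs.le
    · exact Filter.Eventually.of_forall fun s hs => by nlinarith [mul_nonneg hs.le h']
  have hH : ∀ᶠ s in nhds (0 : ℝ), ∀ h ∈ H, 0 < s → 0 ≤ h (x + s • d) := by
    rw [Filter.eventually_all_finset]
    intro h hh
    rcases (((hX x).1 hx).2.2 h hh).eq_or_lt with h1 | h1
    · exact lin 0 h (Or.inr ⟨h1.le, (hd h hh h1.symm).ge⟩)
    · exact lin 0 h (Or.inl h1)
  obtain ⟨u, huU, hu⟩ := hu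
  obtain ⟨v, hvV, hv⟩ := hv
  filter_upwards [lin α u hu, lin β v hv, hH] with s h1 h2 h3 hs
  exact (hX _).2 ⟨⟨u, huU, h1 hs⟩, ⟨v, hvV, h2 hs⟩, fun h hh => h3 h hh hs⟩

/-- The direction `d` leaves `X`. Were `u w ≠ 0`, adding a multiple of `w` would cancel the decrease
of `u` and keep the point in `X`, against invariance. -/
theorem LocallyInvariantAlong.eq_zero_of_far (hinv : LocallyInvariantAlong X x w) (hx : x ∈ X)
    (hU : ∀ u ∈ U, u x ≤ α) (hV : ∃ v ∈ V, β < v x) {d : E3}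
    (hd : ∀ h ∈ H, h x = 0 → h d = 0) (hud : ∀ u ∈ U, u x = α → u d < 0)
    {u : Module.Dual ℝ E3} (hu : u ∈ U) (hux : u x = α) : u w = 0 := by
  by_contra hw
  have hdw : ∀ h ∈ H, h x = 0 → h (d + (-u d / u w) • w) = 0 := by
    intro h hh hhx
    rw [map_add, map_smul, hd h hh hhx, hinv.eq_zero_of_boundary hX hx hh hhx]
    simp
  obtain ⟨v, hv, hvx⟩ := hV
  have h1 := eventually_mem_of_nonneg hX hx hdw
    ⟨u, hu, Or.inr ⟨hux.ge, by
      rw [map_add, map_smul, smul_eq_mul, div_mul_cancel₀ _ hw, add_neg_cancel]⟩⟩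
    ⟨v, hv, Or.inl hvx⟩
  have h2 := eventually_notMem_of_neg hX hU hud
  obtain ⟨s, hs, -, ⟨h1, h2⟩, h3⟩ := exists_pos_lt_of_eventually
    ((h1.and h2).and (hinv.eventually_iff d (-u d / u w))) one_pos
  exact h2 hs (h3.2 (h1 hs))

/-- With both disjunctions tight, two values have to be restored: a multiple of `w` cancels the
decrease of `v`, and a multiple of `e` that of `u`. As `e` does not change the active members of
`V`, the direction `d + σ • e` still leaves `X`. -/
theorem LocallyInvariantAlong.eq_zero_of_crossing (hinv : LocallyInvariantAlong X x w)
    (hx : x ∈ X) (hV : ∀ v ∈ V, v x ≤ β) {d e : E3}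
    (hd : ∀ h ∈ H, h x = 0 → h d = 0) (hvd : ∀ v ∈ V, v x = β → v d < 0)
    (he : ∀ h ∈ H, h x = 0 → h e = 0) (hve : ∀ v ∈ V, v x = β → v e = 0)
    (hue : ∃ u ∈ U, u x = α ∧ u e ≠ 0)
    {v : Module.Dual ℝ E3} (hv : v ∈ V) (hvx : v x = β) : v w = 0 := by
  have hX' : ∀ z, z ∈ X ↔ (∃ v ∈ V, β ≤ v z) ∧ (∃ u ∈ U, α ≤ u z) ∧ ∀ h ∈ H, 0 ≤ h z := by
    intro z
    rw [hX]
    tauto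
  by_contra hw
  obtain ⟨u, hu, hux, hue⟩ := hue
  obtain ⟨t, ht⟩ : ∃ t, v d + t * v w = 0 := ⟨-v d / v w, by field_simp; ring⟩
  obtain ⟨σ, hσ⟩ : ∃ σ, u d + σ * u e + t * u w = 0 :=
    ⟨-(u d + t * u w) / u e, by field_simp; ring⟩
  have hmem := eventually_mem_of_nonneg hX hx (d := d + σ • e + t • w)
    (by
      intro h hh hhx
      simp only [map_add, map_smul, hd h hh hhx, he h hh hhx,
        hinv.eq_zero_of_boundary hX hx hh hhx, smul_zero, add_zero])
    ⟨u, hu, Or.inr ⟨hux.ge, by simp only [map_add, map_smul, smul_eq_mul, hσ, le_refl]⟩⟩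
    ⟨v, hv, Or.inr ⟨hvx.ge, by
      simp only [map_add, map_smul, smul_eq_mul, hve v hv hvx, mul_zero, add_zero, ht, le_refl]⟩⟩
  have hnot := eventually_notMem_of_neg hX' hV (d := d + σ • e) fun v hv hvx => by
    rw [map_add, map_smul, hve v hv hvx, smul_zero, add_zero]
    exact hvd v hv hvx
  obtain ⟨s, hs, -, ⟨h1, h2⟩, h3⟩ := exists_pos_lt_of_eventually
    ((hmem.and hnot).and (hinv.eventually_iff (d + σ • e) t)) one_pos
  exact h2 hs (h3.2 (h1 hs))

theorem not_locallyInvariantAlong_smul (hx : x ∈ X) (hU : ∀ u ∈ U, u x ≤ α) {e : E3}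
    (hue : ∀ u ∈ U, u x = α → u e < 0) {c : ℝ} (hc : c ≠ 0) :
    ¬ LocallyInvariantAlong X x (c • e) := by
  intro hinv
  obtain ⟨s, hs, -, h1, h2⟩ := exists_pos_lt_of_eventually
    ((hinv.eventually_iff 0 c⁻¹).and (eventually_notMem_of_neg hX hU hue)) one_pos
  rw [smul_zero, add_zero, smul_smul, inv_mul_cancel₀ hc, one_smul, zero_add] at h1
  exact h2 hs (h1.1 hx)

end Polyhedral

theorem eq_zero_of_eventually_mem {P : Set E3} {A w : E3} (hA : A ∈ vertices P)
    (h : ∀ᶠ s in nhds (0 : ℝ), A + s • w ∈ P) : w = 0 := by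
  have h' : ∀ᶠ s in nhds (0 : ℝ), A + (-s) • w ∈ P :=
    (show Filter.Tendsto (fun s : ℝ => -s) (nhds 0) (nhds 0) by
      simpa using (continuous_neg (G := ℝ)).tendsto 0).eventually h
  obtain ⟨s, hs, -, h1, h2⟩ := exists_pos_lt_of_eventually (h.and h') one_pos
  rw [neg_smul, ← sub_eq_add_neg] at h2
  have := hA.2 h1 h2 (mem_openSegment_add_sub A w)
  rw [add_eq_left, smul_eq_zero] at this
  exact this.resolve_left hs.ne'

namespace RadialData

variable {P : Set E3} {I J H : Finset (Module.Dual ℝ E3)} (D : RadialData P I J H)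
include D

/-! ### The points of `G P k A` are vertices -/

/-- Negating the near functionals puts both surfaces in the same form; the primed version exchanges
their order. -/
theorem mem_closure_L_iff_neg {k : ℕ} (hk : 0 < k) (hT : k ∈ thresholds P)
    (hedge : EdgesInFrontier P) (z : E3) :
    z ∈ closure (L P k) ↔ (∃ f ∈ I, (k : ℝ) ≤ f z) ∧
      (∃ v ∈ J.map (Equiv.neg _).toEmbedding, -((k : ℝ) + 1) ≤ v z) ∧ ∀ h ∈ H, 0 ≤ h z := by
  rw [D.mem_closure_L_iff hk hT hedge, D.mem_cone_iff]
  simp only [Finset.mem_map_equiv, Equiv.neg_symm, Equiv.neg_apply]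
  constructor
  · rintro ⟨h1, h2, g, hg, h3⟩
    exact ⟨h2, ⟨-g, by simpa using hg, by simpa using h3⟩, h1⟩
  · rintro ⟨h1, ⟨g, hg, h2⟩, h3⟩
    exact ⟨h3, h1, -g, hg, by rw [LinearMap.neg_apply]; linarith⟩

theorem mem_closure_L_iff_neg' {k : ℕ} (hk : 0 < k) (hT : k ∈ thresholds P)
    (hedge : EdgesInFrontier P) (z : E3) :
    z ∈ closure (L P k) ↔ (∃ v ∈ J.map (Equiv.neg _).toEmbedding, -((k : ℝ) + 1) ≤ v z) ∧
      (∃ f ∈ I, (k : ℝ) ≤ f z) ∧ ∀ h ∈ H, 0 ≤ h z := by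
  rw [D.mem_closure_L_iff_neg hk hT hedge]
  tauto

/-- At `k • A` the near condition is slack. Invariance along `w` thus makes all active far and
boundary functionals vanish on `w`, and `A` could be moved both ways along `w` inside `P`. -/
theorem smul_mem_polyhedralVertices {k : ℕ} (hk : 0 < k) (hT : k ∈ thresholds P)
    (hedge : EdgesInFrontier P) {A : E3} (hA : A ∈ W P) :
    (k : ℝ) • A ∈ polyhedralVertices (closure (L P k)) := by
  have hk0 : (0 : ℝ) < k := Nat.cast_pos.2 hk
  have hX := D.mem_closure_L_iff_neg hk hT hedge
  obtain ⟨hAv, ⟨f₀, hf₀, hf₀A⟩, g₀, hg₀, hg₀A⟩ := D.mem_W_iff.1 hA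
  obtain ⟨q1, q2, q3⟩ := (D.mem_iff_cone A).1 hAv.1
  have hval : ∀ l : Module.Dual ℝ E3, l ((k : ℝ) • A) = k * l A := fun l => by simp
  have hx : (k : ℝ) • A ∈ closure (L P k) := by
    rw [D.mem_closure_L_iff hk hT hedge]
    refine ⟨smul_mem_cone q3 hk0.le, ⟨f₀, hf₀, ?_⟩, g₀, hg₀, ?_⟩ <;> rw [hval]
    · rw [hf₀A, mul_one]
    · rw [hg₀A]; linarith
  refine ⟨hx, fun w hw hinv => hw ?_⟩
  have hH : ∀ h ∈ H, h A = 0 → h w = 0 := fun h hh h0 =>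
    hinv.eq_zero_of_boundary hX hx hh (by rw [hval, h0, mul_zero])
  have hF : ∀ f ∈ I, f A = 1 → f w = 0 := fun f hf h1 =>
    hinv.eq_zero_of_far hX hx (fun f hf => by rw [hval]; nlinarith [q1 f hf])
      ⟨-g₀, by simpa [Finset.mem_map_equiv] using hg₀, by
        rw [LinearMap.neg_apply, hval, hg₀A]; linarith⟩ (d := -A)
      (fun h hh h0 => by
        rw [hval] at h0
        rw [map_neg, (mul_eq_zero.1 h0).resolve_left hk0.ne', neg_zero])
      (fun f hf h1 => by
        rw [hval] at h1
        rw [map_neg, mul_left_cancel₀ hk0.ne' (h1.trans (mul_one _).symm)]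
        norm_num)
      hf (by rw [hval, h1, mul_one])
  apply eq_zero_of_eventually_mem hAv
  have hfe : ∀ᶠ s in nhds (0 : ℝ), ∀ f ∈ I, f (A + s • w) ≤ 1 := by
    rw [Filter.eventually_all_finset]
    intro f hf
    simp only [map_add, map_smul, smul_eq_mul]
    rcases (q1 f hf).eq_or_lt with h | h
    · exact Filter.Eventually.of_forall fun s => by rw [hF f hf h, h]; simp
    · exact (eventually_add_mul_lt h _).mono fun s hs => hs.le
  filter_upwards [hfe, D.eventually_add_smul_mem_cone q3 hH] with s h1 h2
  refine (D.mem_iff_cone _).2 ⟨h1, fun g hg => ?_, h2⟩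
  -- The near inequalities come for free: f₀ stays equal to 1 and bounds every g from below on the
  -- cone.
  have := D.le_of_mem_cone _ h2 f₀ hf₀ g hg
  rwa [map_add, map_smul, hF f₀ hf₀ hf₀A, smul_zero, add_zero, hf₀A] at this

theorem succ_smul_mem_polyhedralVertices {k : ℕ} (hk : 0 < k) (hT : k ∈ thresholds P)
    (hedge : EdgesInFrontier P) {A : E3} (hA : A ∈ W P) :
    ((k : ℝ) + 1) • A ∈ polyhedralVertices (closure (L P k)) := by
  have hk0 : (0 : ℝ) < (k : ℝ) + 1 := by positivity
  have hX := D.mem_closure_L_iff_neg' hk hT hedge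
  obtain ⟨hAv, ⟨f₀, hf₀, hf₀A⟩, g₀, hg₀, hg₀A⟩ := D.mem_W_iff.1 hA
  obtain ⟨q1, q2, q3⟩ := (D.mem_iff_cone A).1 hAv.1
  have hval : ∀ l : Module.Dual ℝ E3, l (((k : ℝ) + 1) • A) = ((k : ℝ) + 1) * l A :=
    fun l => by simp
  have hx : ((k : ℝ) + 1) • A ∈ closure (L P k) := by
    rw [D.mem_closure_L_iff hk hT hedge]
    refine ⟨smul_mem_cone q3 hk0.le, ⟨f₀, hf₀, ?_⟩, g₀, hg₀, ?_⟩ <;> rw [hval]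
    · rw [hf₀A]; linarith
    · rw [hg₀A, mul_one]
  refine ⟨hx, fun w hw hinv => hw ?_⟩
  have hH : ∀ h ∈ H, h A = 0 → h w = 0 := fun h hh h0 =>
    hinv.eq_zero_of_boundary hX hx hh (by rw [hval, h0, mul_zero])
  have hG : ∀ g ∈ J, g A = 1 → g w = 0 := by
    intro g hg h1
    have := hinv.eq_zero_of_far hX hx
      (fun v hv => by
        have := q2 (-v) (by simpa [Finset.mem_map_equiv] using hv)
        rw [LinearMap.neg_apply] at this
        rw [hval]
        nlinarith)
      ⟨f₀, hf₀, by rw [hval, hf₀A]; linarith⟩ (d := A)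
      (fun h hh h0 => by
        rw [hval] at h0
        exact (mul_eq_zero.1 h0).resolve_left hk0.ne')
      (fun v hv h1 => by
        rw [hval] at h1
        have : v A = -1 := mul_left_cancel₀ hk0.ne' (by linarith)
        rw [this]
        norm_num)
      (u := -g) (by simpa [Finset.mem_map_equiv] using hg)
      (by rw [LinearMap.neg_apply, hval, h1, mul_one])
    simpa using this
  apply eq_zero_of_eventually_mem hAv
  have hge : ∀ᶠ s in nhds (0 : ℝ), ∀ g ∈ J, 1 ≤ g (A + s • w) := by
    rw [Filter.eventually_all_finset]
    intro g hg
    simp only [map_add, map_smul, smul_eq_mul]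
    rcases (q2 g hg).eq_or_lt with h | h
    · exact Filter.Eventually.of_forall fun s => by rw [hG g hg h.symm, ← h]; simp
    · exact (eventually_lt_add_mul h _).mono fun s hs => hs.le
  filter_upwards [hge, D.eventually_add_smul_mem_cone q3 hH] with s h1 h2
  refine (D.mem_iff_cone _).2 ⟨fun f hf => ?_, h1, h2⟩
  have := D.le_of_mem_cone _ h2 f hf g₀ hg₀
  rwa [map_add g₀, map_smul g₀, hG g₀ hg₀ hg₀A, smul_zero, add_zero, hg₀A] at this

/-- On an open edge starting in `W P`, at least one radial constraint is active, and the direction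
of the edge spans the direction space of the minimal face. -/
theorem edge_activeKer {A Q y : E3} (hA : A ∈ W P) (hadj : Adjacent P A Q)
    (hy : y ∈ openSegment ℝ A Q) :
    Q - A ∈ activeKer (constraints I J H) y ∧
      (∀ w ∈ activeKer (constraints I J H) y, ∃ c : ℝ, w = c • (Q - A)) ∧
      ((∃ f ∈ I, f y = 1) ∨ ∃ g ∈ J, g y = 1) := by
  have e := D.eq_halfSpaces
  have hyP : y ∈ P := hadj.2.2.2.subset (openSegment_subset_segment ℝ _ _ hy)
  have hAy : y ≠ A := by
    rintro rfl
    exact hadj.2.2.1 (left_mem_openSegment_iff.1 hy)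
  have hline : ∀ z ∈ segment ℝ A Q, ∃ c : ℝ, z - y = c • (Q - A) := by
    rw [openSegment_eq_image'] at hy
    rw [segment_eq_image']
    obtain ⟨b, -, rfl⟩ := hy
    rintro z ⟨c, -, rfl⟩
    exact ⟨c - b, by simp only [sub_smul]; abel⟩
  have hspan : ∀ w ∈ activeKer (constraints I J H) y, ∃ c : ℝ, w = c • (Q - A) := by
    intro w hw
    obtain ⟨s, hs, h1, h2⟩ := exists_pos_add_sub_mem (e ▸ hyP) hw
    rw [← e] at h1 h2
    -- Extremality of the edge forces `y + s • w` onto it, so `w` is parallel to the edge.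
    obtain ⟨c, hc⟩ := hline _ (hadj.2.2.2.left_mem_of_mem_openSegment h1 h2
      (openSegment_subset_segment ℝ _ _ hy) (mem_openSegment_add_sub y w))
    refine ⟨s⁻¹ * c, ?_⟩
    rw [add_sub_cancel_left] at hc
    rw [mul_smul, ← hc, smul_smul, inv_mul_cancel₀ hs.ne', one_smul]
  refine ⟨?_, hspan, ?_⟩
  · have h1 := sub_mem_activeKer (e ▸ hadj.1.1) (e ▸ hadj.2.1.1) hy
    have h2 := sub_mem_activeKer (e ▸ hadj.2.1.1) (e ▸ hadj.1.1) (openSegment_symm ℝ A Q ▸ hy)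
    rw [← sub_sub_sub_cancel_right Q A y]
    exact Submodule.sub_mem _ h2 h1
  -- Otherwise the edge would be radial, but the ray of a point of `W P` meets `P` only there.
  · by_contra! h
    obtain ⟨c, hc⟩ := hspan y (mem_activeKer_constraints.2
      ⟨fun f hf h' => absurd h' (h.1 f hf), fun g hg h' => absurd h' (h.2 g hg), fun _ _ h' => h'⟩)
    obtain ⟨b, hb⟩ := hline A (left_mem_segment ℝ _ _)
    have hy0 := D.ne_zero_of_mem hyP
    have hc0 : c ≠ 0 := by
      rintro rfl
      rw [zero_smul] at hc
      exact hy0 hc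
    have hAe : A = ((b + c) / c) • y := by
      have h2 : A = b • (Q - A) + y := by rw [← hb, sub_add_cancel]
      have h3 : Q - A = c⁻¹ • y := by
        rw [hc, smul_smul, inv_mul_cancel₀ hc0, one_smul]
      rw [h3, smul_smul] at h2
      rw [add_div, div_self hc0, add_smul, one_smul, div_eq_mul_inv]
      exact h2
    have hA0 := D.ne_zero_of_mem hA.1.1
    have hr : (b + c) / c ≠ 0 := by
      intro h
      rw [h, zero_smul] at hAe
      exact hA0 hAe
    have hyA : ((b + c) / c)⁻¹ • A = y := by
      nth_rw 1 [hAe]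
      rw [smul_smul, inv_mul_cancel₀ hr, one_smul]
    have := D.eq_of_mem_W_of_smul_mem hA (hyA.symm ▸ hyP)
    rw [hyA] at this
    exact hAy this

/-- The edge direction `Q - A` preserves the active near and boundary functionals and strictly
lowers every active far one. Hence an invariance direction is parallel to the edge, but the set ends
at `x` in the direction `Q - A`. -/
theorem near_crossing_mem_polyhedralVertices {k : ℕ} (hk : 0 < k) (hT : k ∈ thresholds P)
    (hedge : EdgesInFrontier P) {A Q x : E3} (hA : A ∈ W P) (hQ : Q ∈ nearNeighbours P A)
    (hx1 : x ∈ ((k : ℝ) + 1) • segment ℝ A Q) (hx2 : x ∈ (k : ℝ) • relBoundary (cone P) P) :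
    x ∈ polyhedralVertices (closure (L P k)) := by
  have hk0 : (0 : ℝ) < k := Nat.cast_pos.2 hk
  have hk1 : (0 : ℝ) < (k : ℝ) + 1 := by positivity
  have hX := D.mem_closure_L_iff_neg hk hT hedge
  obtain ⟨hQnear, hadj⟩ := hQ
  obtain ⟨y, hy, rfl⟩ := hx1
  obtain ⟨b, hb, hbx⟩ := hx2
  simp only at hbx
  have hyP : y ∈ P := hadj.2.2.2.subset hy
  obtain ⟨q1, q2, q3⟩ := (D.mem_iff_cone y).1 hyP
  obtain ⟨hbP, hb⟩ := (D.mem_relBoundary_iff b).1 hb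
  obtain ⟨b1, b2, b3⟩ := (D.mem_iff_cone b).1 hbP
  have hval : ∀ l : Module.Dual ℝ E3, ((k : ℝ) + 1) * l y = k * l b := fun l => by
    have := congrArg l hbx
    simpa using this.symm
  have hval' : ∀ l : Module.Dual ℝ E3, l (((k : ℝ) + 1) • y) = ((k : ℝ) + 1) * l y :=
    fun l => by simp
  have hfle : ∀ f ∈ I, ((k : ℝ) + 1) * f y ≤ k := fun f hf => by
    rw [hval]; nlinarith [b1 f hf]
  -- A near functional equal to 1 at b would give (k + 1) g y = k, impossible since g y ≥ 1.
  obtain ⟨f₀, hf₀, hf₀y⟩ : ∃ f ∈ I, ((k : ℝ) + 1) * f y = k := by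
    rcases hb with ⟨f, hf, h⟩ | ⟨g, hg, h⟩
    · exact ⟨f, hf, by rw [hval, h, mul_one]⟩
    · have := hval g
      rw [h, mul_one] at this
      nlinarith [q2 g hg]
  obtain ⟨-, ⟨fA, hfA, hfA1⟩, -⟩ := D.mem_W_iff.1 hA
  have hyA : A ≠ y := by
    rintro rfl
    have := hfle fA hfA
    rw [hfA1] at this
    linarith
  have hyQ : Q ≠ y := by
    rintro rfl
    exact (D.lt_of_mem_near hk hT hQnear hf₀).ne hf₀y
  have hyo := mem_openSegment_of_ne_left_right hyA hyQ hy
  obtain ⟨hker, hspan, hact⟩ := D.edge_activeKer hA hadj hyo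
  have hflt : ∀ f ∈ I, f y < 1 := fun f hf => by nlinarith [hfle f hf]
  obtain ⟨f, hf, h⟩ | ⟨g₀, hg₀, hg₀y⟩ := hact
  · exact absurd h (hflt f hf).ne
  have hue : ∀ f ∈ I, f (((k : ℝ) + 1) • y) = k → f (Q - A) < 0 := by
    intro f hf hfx
    rw [hval'] at hfx
    have h2 := D.lt_of_mem_near hk hT hQnear hf
    obtain ⟨a, c, ha, hc, hac, rfl⟩ := hyo
    rw [map_sub, sub_neg]
    by_contra! hle
    simp only [map_add, map_smul, smul_eq_mul] at hfx
    have h3 : a * f A + c * f Q ≤ f Q := by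
      nlinarith [mul_le_mul_of_nonneg_left hle ha.le, show f Q = a * f Q + c * f Q by
        rw [← add_mul, hac, one_mul]]
    nlinarith
  have hx : ((k : ℝ) + 1) • y ∈ closure (L P k) := by
    rw [D.mem_closure_L_iff hk hT hedge]
    refine ⟨smul_mem_cone q3 hk1.le, ⟨f₀, hf₀, ?_⟩, g₀, hg₀, ?_⟩ <;> rw [hval']
    · exact hf₀y.ge
    · rw [hg₀y, mul_one]
  have hzero : ∀ h ∈ H, h (((k : ℝ) + 1) • y) = 0 → h y = 0 := fun h _ h0 => by
    rw [hval'] at h0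
    exact (mul_eq_zero.1 h0).resolve_left hk1.ne'
  rw [mem_activeKer_constraints] at hker
  refine ⟨hx, fun w hw hinv => ?_⟩
  have hwker : w ∈ activeKer (constraints I J H) y := by
    rw [mem_activeKer_constraints]
    refine ⟨fun f hf h => absurd h (hflt f hf).ne, fun g hg h => ?_, fun h hh h0 =>
      hinv.eq_zero_of_boundary hX hx hh (by rw [hval', h0, mul_zero])⟩
    have hneg : ∀ v ∈ J.map (Equiv.neg _).toEmbedding, -v ∈ J := fun v hv => by
      simpa [Finset.mem_map_equiv] using hv
    -- The outward radial direction leaves the set through the near surface; the edge direction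
    -- adjusts the far value without affecting the active near ones.
    have := hinv.eq_zero_of_crossing hX hx
      (fun v hv => by
        have := q2 _ (hneg v hv)
        rw [LinearMap.neg_apply] at this
        rw [hval']
        nlinarith)
      (d := ((k : ℝ) + 1) • y) (e := Q - A) (fun _ _ h => h)
      (fun v hv h => by rw [h]; linarith)
      (fun h hh h0 => hker.2.2 h hh (hzero h hh h0))
      (fun v hv h => by
        rw [hval'] at h
        have h1 : v y = -1 := mul_left_cancel₀ hk1.ne' (by linarith)
        have := hker.2.1 _ (hneg v hv) (by rw [LinearMap.neg_apply, h1, neg_neg])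
        rwa [LinearMap.neg_apply, neg_eq_zero] at this)
      ⟨f₀, hf₀, by rw [hval', hf₀y], (hue f₀ hf₀ (by rw [hval', hf₀y])).ne⟩
      (v := -g) (by simpa [Finset.mem_map_equiv] using hg)
      (by rw [LinearMap.neg_apply, hval', h, mul_one])
    simpa using this
  obtain ⟨c, rfl⟩ := hspan w hwker
  refine not_locallyInvariantAlong_smul hX hx (fun f hf => by rw [hval']; exact hfle f hf) hue ?_ hinv
  rintro rfl
  simp at hw

/-- The mirror image: the edge lies on the far surface, and every near functional active at `x`
strictly increases from `A` to `Q`. -/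
theorem far_crossing_mem_polyhedralVertices {k : ℕ} (hk : 0 < k) (hT : k ∈ thresholds P)
    (hedge : EdgesInFrontier P) {A Q x : E3} (hA : A ∈ W P) (hQ : Q ∈ farNeighbours P A)
    (hx1 : x ∈ (k : ℝ) • segment ℝ A Q) (hx2 : x ∈ ((k : ℝ) + 1) • relBoundary (cone P) P) :
    x ∈ polyhedralVertices (closure (L P k)) := by
  have hk0 : (0 : ℝ) < k := Nat.cast_pos.2 hk
  have hk1 : (0 : ℝ) < (k : ℝ) + 1 := by positivity
  have hX := D.mem_closure_L_iff_neg' hk hT hedge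
  have hneg : ∀ v ∈ J.map (Equiv.neg _).toEmbedding, -v ∈ J := fun v hv => by
    simpa [Finset.mem_map_equiv] using hv
  obtain ⟨hQfar, hadj⟩ := hQ
  obtain ⟨y, hy, rfl⟩ := hx1
  obtain ⟨b, hb, hbx⟩ := hx2
  simp only at hbx
  have hyP : y ∈ P := hadj.2.2.2.subset hy
  obtain ⟨q1, q2, q3⟩ := (D.mem_iff_cone y).1 hyP
  obtain ⟨hbP, hb⟩ := (D.mem_relBoundary_iff b).1 hb
  obtain ⟨b1, b2, b3⟩ := (D.mem_iff_cone b).1 hbP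
  have hval : ∀ l : Module.Dual ℝ E3, k * l y = ((k : ℝ) + 1) * l b := fun l => by
    have := congrArg l hbx
    simpa using this.symm
  have hval' : ∀ l : Module.Dual ℝ E3, l ((k : ℝ) • y) = k * l y := fun l => by simp
  have hgle : ∀ g ∈ J, (k : ℝ) + 1 ≤ k * g y := fun g hg => by
    rw [hval]; nlinarith [b2 g hg]
  obtain ⟨g₀, hg₀, hg₀y⟩ : ∃ g ∈ J, k * g y = (k : ℝ) + 1 := by
    rcases hb with ⟨f, hf, h⟩ | ⟨g, hg, h⟩
    · have := hval f
      rw [h, mul_one] at this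
      nlinarith [q1 f hf]
    · exact ⟨g, hg, by rw [hval, h, mul_one]⟩
  obtain ⟨-, -, ⟨gA, hgA, hgA1⟩⟩ := D.mem_W_iff.1 hA
  have hyA : A ≠ y := by
    rintro rfl
    have := hgle gA hgA
    rw [hgA1] at this
    linarith
  have hyQ : Q ≠ y := by
    rintro rfl
    exact (D.lt_of_mem_far hT hQfar hg₀).ne' hg₀y
  have hyo := mem_openSegment_of_ne_left_right hyA hyQ hy
  obtain ⟨hker, hspan, hact⟩ := D.edge_activeKer hA hadj hyo
  have hglt : ∀ g ∈ J, 1 < g y := fun g hg => by nlinarith [hgle g hg]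
  obtain ⟨f₀, hf₀, hf₀y⟩ | ⟨g, hg, h⟩ := hact
  swap
  · exact absurd h (hglt g hg).ne'
  have hue : ∀ v ∈ J.map (Equiv.neg _).toEmbedding,
      v ((k : ℝ) • y) = -((k : ℝ) + 1) → v (Q - A) < 0 := by
    intro v hv hvx
    rw [hval'] at hvx
    have h2 := D.lt_of_mem_far hT hQfar (hneg v hv)
    rw [LinearMap.neg_apply] at h2
    obtain ⟨a, c, ha, hc, hac, rfl⟩ := hyo
    rw [map_sub, sub_neg]
    by_contra! hle
    simp only [map_add, map_smul, smul_eq_mul] at hvx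
    have h3 : a * v A + c * v Q ≤ v Q := by
      nlinarith [mul_le_mul_of_nonneg_left hle ha.le, show v Q = a * v Q + c * v Q by
        rw [← add_mul, hac, one_mul]]
    nlinarith
  have hx : (k : ℝ) • y ∈ closure (L P k) := by
    rw [D.mem_closure_L_iff hk hT hedge]
    refine ⟨smul_mem_cone q3 hk0.le, ⟨f₀, hf₀, ?_⟩, g₀, hg₀, ?_⟩ <;> rw [hval']
    · rw [hf₀y, mul_one]
    · exact hg₀y.le
  have hzero : ∀ h ∈ H, h ((k : ℝ) • y) = 0 → h y = 0 := fun h _ h0 => by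
    rw [hval'] at h0
    exact (mul_eq_zero.1 h0).resolve_left hk0.ne'
  rw [mem_activeKer_constraints] at hker
  refine ⟨hx, fun w hw hinv => ?_⟩
  have hwker : w ∈ activeKer (constraints I J H) y := by
    rw [mem_activeKer_constraints]
    refine ⟨fun f hf h => ?_, fun g hg h => absurd h (hglt g hg).ne', fun h hh h0 =>
      hinv.eq_zero_of_boundary hX hx hh (by rw [hval', h0, mul_zero])⟩
    refine hinv.eq_zero_of_crossing hX hx
      (fun f hf => by
        rw [hval']
        nlinarith [q1 f hf])
      (d := -((k : ℝ) • y)) (e := Q - A) (fun _ _ h => by rw [map_neg, h, neg_zero])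
      (fun f hf h => by rw [map_neg, h]; linarith)
      (fun h hh h0 => hker.2.2 h hh (hzero h hh h0))
      (fun f hf h => by
        rw [hval'] at h
        exact hker.1 f hf (mul_left_cancel₀ hk0.ne' (h.trans (mul_one _).symm)))
      ⟨-g₀, by simpa [Finset.mem_map_equiv] using hg₀, by
        rw [LinearMap.neg_apply, hval', hg₀y], (hue (-g₀)
          (by simpa [Finset.mem_map_equiv] using hg₀)
          (by rw [LinearMap.neg_apply, hval', hg₀y])).ne⟩
      hf (by rw [hval', h, mul_one])
  obtain ⟨c, rfl⟩ := hspan w hwker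
  refine not_locallyInvariantAlong_smul hX hx (fun v hv => ?_) hue ?_ hinv
  · have := hgle _ (hneg v hv)
    rw [LinearMap.neg_apply] at this
    rw [hval']
    linarith
  · rintro rfl
    simp at hw

theorem G_subset_polyhedralVertices {k : ℕ} (hk : 0 < k) (hT : k ∈ thresholds P)
    (hedge : EdgesInFrontier P) {A : E3} (hA : A ∈ W P) :
    G P k A ⊆ polyhedralVertices (closure (L P k)) := by
  rintro x ((hx | hx) | hx)
  · rcases hx with rfl | rfl
    · exact D.smul_mem_polyhedralVertices hk hT hedge hA
    · exact D.succ_smul_mem_polyhedralVertices hk hT hedge hA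
  · simp only [Set.mem_iUnion, exists_prop] at hx
    obtain ⟨Q, hQ, h1, h2⟩ := hx
    exact D.near_crossing_mem_polyhedralVertices hk hT hedge hA hQ h1 h2
  · simp only [Set.mem_iUnion, exists_prop] at hx
    obtain ⟨Q, hQ, h1, h2⟩ := hx
    exact D.far_crossing_mem_polyhedralVertices hk hT hedge hA hQ h1 h2

end RadialData

theorem mem_activeKer_inv_smul {I J H : Finset (Module.Dual ℝ E3)} {x w : E3} {t : ℝ} (ht : 0 < t) :
    w ∈ activeKer (constraints I J H) (t⁻¹ • x) ↔ (∀ f ∈ I, f x = t → f w = 0) ∧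
      (∀ g ∈ J, g x = t → g w = 0) ∧ ∀ h ∈ H, h x = 0 → h w = 0 := by
  rw [mem_activeKer_constraints]
  simp only [map_smul, smul_eq_mul, inv_mul_eq_one₀ ht.ne', mul_eq_zero, inv_eq_zero, ht.ne',
    false_or, eq_comm (a := t)]

namespace RadialData

variable {P : Set E3} {I J H : Finset (Module.Dual ℝ E3)} (D : RadialData P I J H)
include D

/-! ### The vertices belong to the sets `G P k A` -/

/-- At a point of `W P` some far and near functionals agree; adding a cone vector cannot close the
strict gap at `y`. -/
theorem ne_of_mem_W {A y c : E3} (hA : A ∈ W P) (hc : c ∈ cone P)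
    (hy : ∀ f ∈ I, ∀ g ∈ J, f y < g y) {ε : ℝ} (hε : 0 < ε) : A ≠ ε • y + c := by
  intro h
  obtain ⟨-, ⟨f, hf, h1⟩, g, hg, h2⟩ := D.mem_W_iff.1 hA
  rw [h] at h1 h2
  simp only [map_add, map_smul, smul_eq_mul] at h1 h2
  have h3 := mul_lt_mul_of_pos_left (hy f hf g hg) hε
  linarith [D.le_of_mem_cone c hc f hf g hg]

/-- If `b < 0`, then solving for `A'` writes it as a positive multiple of `y` plus a nonnegative
multiple of `A`, which `ne_of_mem_W` forbids. If `b = 0`, the two points share a ray. -/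
theorem eq_of_eq_smul_add_smul {A A' B' y : E3} (hA : A ∈ W P) (hA' : A' ∈ W P)
    (hy : ∀ f ∈ I, ∀ g ∈ J, f y < g y) (hyo : y ∈ openSegment ℝ A' B') {a b : ℝ}
    (ha : 0 < a) (hb : b ≤ 0) (h : A = a • A' + b • B') : A = A' := by
  rcases hb.eq_or_lt with rfl | hb
  · rw [zero_smul, add_zero] at h
    rw [h]
    exact D.eq_of_mem_W_of_smul_mem hA' (h ▸ hA.1.1)
  · exfalso
    obtain ⟨p, q, hp, hq, -, rfl⟩ := hyo
    have hd : 0 < a * q - b * p := by nlinarith [mul_pos ha hq, mul_pos (neg_pos.2 hb) hp]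
    refine D.ne_of_mem_W hA' (c := (q / (a * q - b * p)) • A)
      (smul_mem_cone (subset_cone P hA.1.1) (by positivity)) hy
      (ε := -b / (a * q - b * p)) (div_pos (neg_pos.2 hb) hd) ?_
    rw [h]
    have e1 : -b / (a * q - b * p) * p + q / (a * q - b * p) * a = 1 := by
      field_simp; ring
    have e2 : -b / (a * q - b * p) * q + q / (a * q - b * p) * b = 0 := by
      field_simp; ring
    simp only [smul_add, smul_smul]
    rw [add_add_add_comm, ← add_smul, ← add_smul, e1, e2, one_smul, zero_smul, add_zero]

/-- In a two-dimensional face of the cone, the points of `W P` are the end points of any edge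
with end points in `W P` that leaves room for a proper radial segment. -/
theorem eq_or_eq_of_mem_W {A A' B' y : E3} (hA : A ∈ W P) (hA' : A' ∈ W P) (hB' : B' ∈ W P)
    (hne : A' ≠ B') (hy : ∀ f ∈ I, ∀ g ∈ J, f y < g y) (hyo : y ∈ openSegment ℝ A' B')
    {h : Module.Dual ℝ E3} (hh : h ≠ 0) (h1 : h A = 0) (h2 : h A' = 0) (h3 : h B' = 0) :
    A = A' ∨ A = B' := by
  have hind : LinearIndependent ℝ ![A', B'] := by
    rw [LinearIndependent.pair_iff]
    intro s t hst
    have hs : s = 0 := by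
      by_contra hs
      have e : A' = (-t / s) • B' := by
        have : s • A' = (-t) • B' := by rw [neg_smul]; exact eq_neg_of_add_eq_zero_left hst
        rw [div_eq_inv_mul, mul_smul, ← this, smul_smul, inv_mul_cancel₀ hs, one_smul]
      have := D.eq_of_mem_W_of_smul_mem hB' (e ▸ hA'.1.1)
      exact hne (e.trans this)
    subst hs
    rw [zero_smul, zero_add] at hst
    exact ⟨rfl, (smul_eq_zero.1 hst).resolve_right (D.ne_zero_of_mem hB'.1.1)⟩
  have hspan : Submodule.span ℝ {A', B'} = LinearMap.ker h := by
    refine Submodule.eq_of_le_of_finrank_eq ?_ ?_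
    · rw [Submodule.span_le]
      rintro z (rfl | rfl)
      · exact h2
      · exact h3
    · have := finrank_span_eq_card hind
      rw [finrank_ker_dual hh]
      rwa [Matrix.range_cons_cons_empty, Fintype.card_fin] at this
  have hmem : A ∈ Submodule.span ℝ {A', B'} := by rw [hspan]; exact h1
  obtain ⟨a, b, hab⟩ := Submodule.mem_span_pair.1 hmem
  -- With both coefficients positive, a multiple of `y` can be split off `A`, leaving a cone vector;
  -- with both nonpositive, a near functional would be nonpositive at `A`. Mixed signs put `A` at an
  -- end.
  rcases lt_or_ge 0 a with ha | ha
  · rcases lt_or_ge 0 b with hb | hb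
    · exfalso
      obtain ⟨p, q, hp, hq, -, rfl⟩ := hyo
      have hC := subset_cone P hA'.1.1
      have hC' := subset_cone P hB'.1.1
      obtain ⟨ε, hε, hεp, hεq⟩ : ∃ ε : ℝ, 0 < ε ∧ ε * p ≤ a ∧ ε * q ≤ b := by
        refine ⟨min (a / p) (b / q), lt_min (div_pos ha hp) (div_pos hb hq), ?_, ?_⟩
        · rw [← le_div_iff₀ hp]; exact min_le_left _ _
        · rw [← le_div_iff₀ hq]; exact min_le_right _ _
      refine D.ne_of_mem_W hA (c := (a - ε * p) • A' + (b - ε * q) • B')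
        (add_mem_cone (smul_mem_cone hC (by linarith)) (smul_mem_cone hC' (by linarith))) hy hε ?_
      rw [← hab]
      simp only [smul_add, smul_smul, sub_smul]
      abel
    · exact Or.inl (D.eq_of_eq_smul_add_smul hA hA' hy hyo ha hb hab.symm)
  · rcases lt_or_ge 0 b with hb | hb
    · exact Or.inr (D.eq_of_eq_smul_add_smul hA hB' hy (openSegment_symm ℝ A' B' ▸ hyo) hb ha
        (by rw [add_comm]; exact hab.symm))
    · exfalso
      obtain ⟨g, hg⟩ := D.near_nonempty
      have e := congrArg g hab
      simp only [map_add, map_smul, smul_eq_mul] at e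
      have q1 := ((D.mem_iff A).1 hA.1.1).2.1 g hg
      have q2 := ((D.mem_iff A').1 hA'.1.1).2.1 g hg
      have q3 := ((D.mem_iff B').1 hB'.1.1).2.1 g hg
      nlinarith

theorem inv_smul_mem {x : E3} {t : ℝ} (ht : 0 < t) (hx : x ∈ cone P) (hf : ∀ f ∈ I, f x ≤ t)
    (hg : ∀ g ∈ J, t ≤ g x) : t⁻¹ • x ∈ P := by
  rw [← Set.mem_smul_set_iff_inv_smul_mem₀ ht.ne', D.mem_smul_iff ht]
  exact ⟨hf, hg, hx⟩

/-- Since g₀ = 1 along the edge, no end is far; two near ends would give f₀ x < k. So at least one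
end lies in `W P`. -/
theorem near_edge_cases {k : ℕ} (hk : 0 < k) (hT : k ∈ thresholds P) {x : E3} (hx : x ∈ cone P)
    (hf : ∀ f ∈ I, f x ≤ k) (hf' : ∃ f ∈ I, f x = k) (hg : ∀ g ∈ J, (k : ℝ) + 1 ≤ g x)
    (hg' : ∃ g ∈ J, g x = (k : ℝ) + 1)
    (hdim : Module.finrank ℝ (activeKer (constraints I J H) (((k : ℝ) + 1)⁻¹ • x)) = 1) :
    (∃ A ∈ W P, x ∈ G P k A) ∨
      ∃ A ∈ W P, ∃ B ∈ W P, Adjacent P A B ∧ ((k : ℝ) + 1)⁻¹ • x ∈ openSegment ℝ A B := by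
  have hk0 : (0 : ℝ) < k := Nat.cast_pos.2 hk
  have hk1 : (0 : ℝ) < (k : ℝ) + 1 := by positivity
  obtain ⟨f₀, hf₀, hf₀x⟩ := hf'
  obtain ⟨g₀, hg₀, hg₀x⟩ := hg'
  have hyP := D.inv_smul_mem hk1 hx (fun f h => (hf f h).trans (by linarith)) hg
  have hyP' := D.inv_smul_mem hk0 hx hf (fun g h => le_trans (by linarith) (hg g h))
  have hb : x ∈ (k : ℝ) • relBoundary (cone P) P := by
    rw [Set.mem_smul_set_iff_inv_smul_mem₀ hk0.ne', D.mem_relBoundary_iff]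
    exact ⟨hyP', Or.inl ⟨f₀, hf₀, by
      rw [map_smul, hf₀x, smul_eq_mul, inv_mul_cancel₀ hk0.ne']⟩⟩
  obtain ⟨A, B, hAB, hy, hA, hB⟩ := D.exists_edge_of_finrank_eq_one hyP hdim
  have hg₀y : g₀ (((k : ℝ) + 1)⁻¹ • x) = 1 := by
    rw [map_smul, hg₀x, smul_eq_mul, inv_mul_cancel₀ hk1.ne']
  have hgv : ∀ A, A - ((k : ℝ) + 1)⁻¹ • x ∈ activeKer (constraints I J H)
      (((k : ℝ) + 1)⁻¹ • x) → g₀ A = 1 := by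
    intro A hA
    have := (mem_activeKer_constraints.1 hA).2.1 g₀ hg₀ hg₀y
    rw [map_sub, hg₀y] at this
    linarith
  have hnear : ∀ A ∈ vertices P, g₀ A = 1 → A ∈ W P ∨ A ∈ V₁ P ∪ W₁ P := by
    intro A hA h1
    rcases D.vertex_cases hA with h | h | h
    · exact Or.inl h
    · exact Or.inr h
    · exact absurd h1 ((D.mem_far_iff.1 h).2 g₀ hg₀).ne'
  have hcross : ∀ A B, A ∈ W P → B ∈ V₁ P ∪ W₁ P → Adjacent P A B →
      ((k : ℝ) + 1)⁻¹ • x ∈ openSegment ℝ A B → x ∈ G P k A := by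
    intro A B _ hB hAB hy
    refine Or.inl (Or.inr ?_)
    simp only [Set.mem_iUnion, exists_prop]
    refine ⟨B, ⟨hB, hAB⟩, ?_, hb⟩
    rw [Set.mem_smul_set_iff_inv_smul_mem₀ hk1.ne']
    exact openSegment_subset_segment ℝ _ _ hy
  rcases hnear A hAB.1 (hgv A hA) with hAW | hAn <;>
    rcases hnear B hAB.2.1 (hgv B hB) with hBW | hBn
  · exact Or.inr ⟨A, hAW, B, hBW, hAB, hy⟩
  · exact Or.inl ⟨A, hAW, hcross A B hAW hBn hAB hy⟩
  · refine Or.inl ⟨B, hBW, hcross B A hBW hAn ⟨hAB.2.1, hAB.1, hAB.2.2.1.symm, ?_⟩ ?_⟩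
    · rw [segment_symm]; exact hAB.2.2.2
    · rw [openSegment_symm]; exact hy
  · exfalso
    have h1 := D.lt_of_mem_near hk hT hAn hf₀
    have h2 := D.lt_of_mem_near hk hT hBn hf₀
    obtain ⟨p, q, hp, hq, hpq, e⟩ := hy
    have e' := congrArg f₀ e
    simp only [map_add, map_smul, smul_eq_mul, hf₀x] at e'
    rw [eq_inv_mul_iff_mul_eq₀ hk1.ne'] at e'
    nlinarith [mul_lt_mul_of_pos_left h1 hp, mul_lt_mul_of_pos_left h2 hq,
      show (k : ℝ) = p * k + q * k by rw [← add_mul, hpq, one_mul]]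

/-- Since f₀ = 1 along the edge, no end is near; two far ends would give g₀ x > k + 1. -/
theorem far_edge_cases {k : ℕ} (hk : 0 < k) (hT : k ∈ thresholds P) {x : E3} (hx : x ∈ cone P)
    (hf : ∀ f ∈ I, f x ≤ k) (hf' : ∃ f ∈ I, f x = k) (hg : ∀ g ∈ J, (k : ℝ) + 1 ≤ g x)
    (hg' : ∃ g ∈ J, g x = (k : ℝ) + 1)
    (hdim : Module.finrank ℝ (activeKer (constraints I J H) ((k : ℝ)⁻¹ • x)) = 1) :
    (∃ A ∈ W P, x ∈ G P k A) ∨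
      ∃ A ∈ W P, ∃ B ∈ W P, Adjacent P A B ∧ (k : ℝ)⁻¹ • x ∈ openSegment ℝ A B := by
  have hk0 : (0 : ℝ) < k := Nat.cast_pos.2 hk
  have hk1 : (0 : ℝ) < (k : ℝ) + 1 := by positivity
  obtain ⟨f₀, hf₀, hf₀x⟩ := hf'
  obtain ⟨g₀, hg₀, hg₀x⟩ := hg'
  have hyP := D.inv_smul_mem hk1 hx (fun f h => (hf f h).trans (by linarith)) hg
  have hyP' := D.inv_smul_mem hk0 hx hf (fun g h => le_trans (by linarith) (hg g h))
  have hb : x ∈ ((k : ℝ) + 1) • relBoundary (cone P) P := by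
    rw [Set.mem_smul_set_iff_inv_smul_mem₀ hk1.ne', D.mem_relBoundary_iff]
    exact ⟨hyP, Or.inr ⟨g₀, hg₀, by
      rw [map_smul, hg₀x, smul_eq_mul, inv_mul_cancel₀ hk1.ne']⟩⟩
  obtain ⟨A, B, hAB, hy, hA, hB⟩ := D.exists_edge_of_finrank_eq_one hyP' hdim
  have hf₀y : f₀ ((k : ℝ)⁻¹ • x) = 1 := by
    rw [map_smul, hf₀x, smul_eq_mul, inv_mul_cancel₀ hk0.ne']
  have hfv : ∀ A, A - (k : ℝ)⁻¹ • x ∈ activeKer (constraints I J H)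
      ((k : ℝ)⁻¹ • x) → f₀ A = 1 := by
    intro A hA
    have := (mem_activeKer_constraints.1 hA).1 f₀ hf₀ hf₀y
    rw [map_sub, hf₀y] at this
    linarith
  have hfar : ∀ A ∈ vertices P, f₀ A = 1 → A ∈ W P ∨ A ∈ V₂ P ∪ W₂ P := by
    intro A hA h1
    rcases D.vertex_cases hA with h | h | h
    · exact Or.inl h
    · exact absurd h1 ((D.mem_near_iff.1 h).2 f₀ hf₀).ne
    · exact Or.inr h
  have hcross : ∀ A B, A ∈ W P → B ∈ V₂ P ∪ W₂ P → Adjacent P A B →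
      (k : ℝ)⁻¹ • x ∈ openSegment ℝ A B → x ∈ G P k A := by
    intro A B _ hB hAB hy
    refine Or.inr ?_
    simp only [Set.mem_iUnion, exists_prop]
    refine ⟨B, ⟨hB, hAB⟩, ?_, hb⟩
    rw [Set.mem_smul_set_iff_inv_smul_mem₀ hk0.ne']
    exact openSegment_subset_segment ℝ _ _ hy
  rcases hfar A hAB.1 (hfv A hA) with hAW | hAn <;>
    rcases hfar B hAB.2.1 (hfv B hB) with hBW | hBn
  · exact Or.inr ⟨A, hAW, B, hBW, hAB, hy⟩
  · exact Or.inl ⟨A, hAW, hcross A B hAW hBn hAB hy⟩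
  · refine Or.inl ⟨B, hBW, hcross B A hBW hAn ⟨hAB.2.1, hAB.1, hAB.2.2.1.symm, ?_⟩ ?_⟩
    · rw [segment_symm]; exact hAB.2.2.2
    · rw [openSegment_symm]; exact hy
  · exfalso
    have h1 := D.lt_of_mem_far hT hAn hg₀
    have h2 := D.lt_of_mem_far hT hBn hg₀
    obtain ⟨p, q, hp, hq, hpq, e⟩ := hy
    have e' := congrArg g₀ e
    simp only [map_add, map_smul, smul_eq_mul, hg₀x] at e'
    rw [eq_inv_mul_iff_mul_eq₀ hk0.ne'] at e'
    nlinarith [mul_lt_mul_of_pos_left h1 hp, mul_lt_mul_of_pos_left h2 hq,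
      show (k : ℝ) + 1 = p * (k + 1) + q * (k + 1) by rw [← add_mul, hpq, one_mul]]

/-- A vertex on both boundary surfaces is a point of some `G P k A`. -/
theorem exists_mem_G_of_crossing {k : ℕ} (hk : 0 < k) (hT : k ∈ thresholds P)
    (hedge : EdgesInFrontier P) {x : E3} (hx : x ∈ cone P)
    (hf : ∀ f ∈ I, f x ≤ k) (hf' : ∃ f ∈ I, f x = k) (hg : ∀ g ∈ J, (k : ℝ) + 1 ≤ g x)
    (hg' : ∃ g ∈ J, g x = (k : ℝ) + 1)
    (hker : ∀ w : E3, (∀ f ∈ I, f x = k → f w = 0) → (∀ g ∈ J, g x = (k : ℝ) + 1 → g w = 0) →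
      (∀ h ∈ H, h x = 0 → h w = 0) → w = 0) :
    ∃ A ∈ W P, x ∈ G P k A := by
  have hk0 : (0 : ℝ) < k := Nat.cast_pos.2 hk
  have hk1 : (0 : ℝ) < (k : ℝ) + 1 := by positivity
  have hyP := D.inv_smul_mem hk1 hx (fun f h => (hf f h).trans (by linarith)) hg
  have hyP' := D.inv_smul_mem hk0 hx hf (fun g h => le_trans (by linarith) (hg g h))
  have near := D.near_edge_cases hk hT hx hf hf' hg hg'
  have far := D.far_edge_cases hk hT hx hf hf' hg hg'
  obtain ⟨f₀, hf₀, hf₀x⟩ := hf'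
  obtain ⟨g₀, hg₀, hg₀x⟩ := hg'
  have hval : ∀ (l : Module.Dual ℝ E3) (t : ℝ), l (t⁻¹ • x) = l x / t := fun l t => by
    rw [map_smul, smul_eq_mul, div_eq_inv_mul]
  have hdisj : Disjoint (activeKer (constraints I J H) (((k : ℝ) + 1)⁻¹ • x))
      (activeKer (constraints I J H) ((k : ℝ)⁻¹ • x)) := by
    rw [Submodule.disjoint_def]
    intro w h1 h2
    rw [mem_activeKer_inv_smul hk1] at h1
    rw [mem_activeKer_inv_smul hk0] at h2
    exact hker w h2.1 h1.2.1 h1.2.2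
  -- Neither x/(k+1) nor x/k can belong to any of the three vertex classes, so both faces have
  -- positive dimension; being independent in dimension three, one of them is an edge.
  have hn0 : Module.finrank ℝ (activeKer (constraints I J H) (((k : ℝ) + 1)⁻¹ • x)) ≠ 0 := by
    intro h
    have hv := (D.mem_vertices_iff hyP).2 (Submodule.finrank_eq_zero.1 h)
    rcases D.vertex_cases hv with h | h | h
    · obtain ⟨-, ⟨f, hf1, h1⟩, -⟩ := D.mem_W_iff.1 h
      rw [hval, div_eq_one_iff_eq hk1.ne'] at h1
      linarith [hf f hf1]
    · have := D.lt_of_mem_near hk hT h hf₀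
      rw [hval, hf₀x, mul_div_cancel₀ _ hk1.ne'] at this
      exact this.false
    · have := (D.mem_far_iff.1 h).2 g₀ hg₀
      rw [hval, hg₀x, div_self hk1.ne'] at this
      exact this.false
  have hf0 : Module.finrank ℝ (activeKer (constraints I J H) ((k : ℝ)⁻¹ • x)) ≠ 0 := by
    intro h
    have hv := (D.mem_vertices_iff hyP').2 (Submodule.finrank_eq_zero.1 h)
    rcases D.vertex_cases hv with h | h | h
    · obtain ⟨-, -, g, hg1, h1⟩ := D.mem_W_iff.1 h
      rw [hval, div_eq_one_iff_eq hk0.ne'] at h1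
      linarith [hg g hg1]
    · have := (D.mem_near_iff.1 h).2 f₀ hf₀
      rw [hval, hf₀x, div_self hk0.ne'] at this
      exact this.false
    · have := D.lt_of_mem_far hT h hg₀
      rw [hval, hg₀x, mul_div_cancel₀ _ hk0.ne'] at this
      exact this.false
  have hsum := Submodule.finrank_add_finrank_le_of_disjoint hdisj
  rw [finrank_euclideanSpace_fin] at hsum
  have hplane : ∀ h ∈ H, h ≠ 0 → h x = 0 →
      Module.finrank ℝ (activeKer (constraints I J H) (((k : ℝ) + 1)⁻¹ • x)) = 1 ∧
      Module.finrank ℝ (activeKer (constraints I J H) ((k : ℝ)⁻¹ • x)) = 1 := by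
    intro h hh hh0 hhx
    have hle : activeKer (constraints I J H) (((k : ℝ) + 1)⁻¹ • x) ⊔
        activeKer (constraints I J H) ((k : ℝ)⁻¹ • x) ≤ LinearMap.ker h :=
      sup_le (fun w hw => ((mem_activeKer_inv_smul hk1).1 hw).2.2 h hh hhx)
        (fun w hw => ((mem_activeKer_inv_smul hk0).1 hw).2.2 h hh hhx)
    have h1 := Submodule.finrank_mono hle
    have h2 := Submodule.finrank_sup_add_finrank_inf_eq
      (activeKer (constraints I J H) (((k : ℝ) + 1)⁻¹ • x))
      (activeKer (constraints I J H) ((k : ℝ)⁻¹ • x))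
    rw [finrank_ker_dual hh0] at h1
    rw [hdisj.eq_bot, finrank_bot] at h2
    omega
  by_contra hnot
  -- With `x` in no `G P k A`, each edge found has both ends in `W P`, so `x` lies in a supporting
  -- plane of the cone; within that plane both faces are edges.
  have front : ∀ {t : ℝ}, 0 < t → ∀ {A B : E3}, A ∈ W P → B ∈ W P → Adjacent P A B →
      t⁻¹ • x ∈ openSegment ℝ A B → ∃ h ∈ H, h ≠ 0 ∧ h x = 0 := by
    intro t ht A B hA hB hAB hy
    obtain ⟨h, hh, h0, hy⟩ := D.exists_of_mem_frontier
      (hedge A hA B hB hAB (openSegment_subset_segment ℝ _ _ hy))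
    rw [hval, div_eq_zero_iff] at hy
    exact ⟨h, hh, h0, hy.resolve_right ht.ne'⟩
  obtain ⟨h, hh, hh0, hhx⟩ : ∃ h ∈ H, h ≠ 0 ∧ h x = 0 := by
    by_cases h1 : Module.finrank ℝ (activeKer (constraints I J H) (((k : ℝ) + 1)⁻¹ • x)) = 1
    · obtain ⟨A, hA, B, hB, hAB, hy⟩ := (near h1).resolve_left hnot
      exact front hk1 hA hB hAB hy
    · obtain ⟨A, hA, B, hB, hAB, hy⟩ := (far (by omega)).resolve_left hnot
      exact front hk0 hA hB hAB hy
  obtain ⟨d1, d2⟩ := hplane h hh hh0 hhx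
  obtain ⟨A, hA, B, hB, hAB, hy⟩ := (near d1).resolve_left hnot
  obtain ⟨A', hA', B', hB', hAB', hy'⟩ := (far d2).resolve_left hnot
  have hends : ∀ {t : ℝ} {A B : E3}, A ∈ P → B ∈ P → t⁻¹ • x ∈ openSegment ℝ A B →
      h A = 0 ∧ h B = 0 := by
    rintro t A B hA hB ⟨p, q, hp, hq, -, e⟩
    have e' := congrArg h e
    rw [hval, hhx, zero_div] at e'
    simp only [map_add, map_smul, smul_eq_mul] at e'
    have q1 := mul_nonneg hp.le (((D.mem_iff A).1 hA).2.2 h hh)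
    have q2 := mul_nonneg hq.le (((D.mem_iff B).1 hB).2.2 h hh)
    exact ⟨(mul_eq_zero.1 (show p * h A = 0 by linarith)).resolve_left hp.ne',
      (mul_eq_zero.1 (show q * h B = 0 by linarith)).resolve_left hq.ne'⟩
  obtain ⟨hhA, hhB⟩ := hends hA.1.1 hB.1.1 hy
  obtain ⟨hhA', hhB'⟩ := hends hA'.1.1 hB'.1.1 hy'
  have hgap : ∀ f ∈ I, ∀ g ∈ J, f ((k : ℝ)⁻¹ • x) < g ((k : ℝ)⁻¹ • x) := by
    intro f h1 g h2
    rw [hval, hval]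
    exact div_lt_div_of_pos_right (by linarith [hf f h1, hg g h2]) hk0
  -- The ends of the near edge are among those of the far edge, so f₀ = 1 along it, although f₀
  -- takes the value k / (k + 1) at x/(k+1).
  have hAcase := D.eq_or_eq_of_mem_W hA hA' hB' hAB'.2.2.1 hgap hy' hh0 hhA hhA' hhB'
  have hBcase := D.eq_or_eq_of_mem_W hB hA' hB' hAB'.2.2.1 hgap hy' hh0 hhB hhA' hhB'
  obtain ⟨hfA', hfB'⟩ : f₀ A' = 1 ∧ f₀ B' = 1 := by
    obtain ⟨p, q, hp, hq, hpq, e⟩ := hy'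
    have e' := congrArg f₀ e
    rw [hval, hf₀x, div_self hk0.ne'] at e'
    simp only [map_add, map_smul, smul_eq_mul] at e'
    have q1 := ((D.mem_iff A').1 hA'.1.1).1 f₀ hf₀
    have q2 := ((D.mem_iff B').1 hB'.1.1).1 f₀ hf₀
    constructor <;> refine le_antisymm ‹_› ?_ <;> by_contra! hlt
    · nlinarith [mul_lt_mul_of_pos_left hlt hp, mul_le_mul_of_nonneg_left q2 hq.le]
    · nlinarith [mul_lt_mul_of_pos_left hlt hq, mul_le_mul_of_nonneg_left q1 hp.le]
  have hfA : f₀ A = 1 := by rcases hAcase with rfl | rfl <;> assumption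
  have hfB : f₀ B = 1 := by rcases hBcase with rfl | rfl <;> assumption
  obtain ⟨p, q, hp, hq, hpq, e⟩ := hy
  have e' := congrArg f₀ e
  rw [hval, hf₀x, eq_div_iff hk1.ne'] at e'
  simp only [map_add, map_smul, smul_eq_mul, hfA, hfB, mul_one, hpq] at e'
  linarith

/-- A slack surface imposes no local condition. Both slack leaves the radial invariance; exactly one
slack makes `x` a dilate of a vertex of `P`, which the threshold places in `W P`; both tight is the
crossing case. -/
theorem exists_mem_G_of_mem_polyhedralVertices {k : ℕ} (hk : 0 < k) (hT : k ∈ thresholds P)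
    (hedge : EdgesInFrontier P) {x : E3} (hx : x ∈ polyhedralVertices (closure (L P k))) :
    ∃ A ∈ W P, x ∈ G P k A := by
  have hk0 : (0 : ℝ) < k := Nat.cast_pos.2 hk
  have hk1 : (0 : ℝ) < (k : ℝ) + 1 := by positivity
  obtain ⟨hxX, hvert⟩ := hx
  have hX : ∀ z, z ∈ closure (L P k) ↔ (∃ f ∈ I, (k : ℝ) ≤ f z) ∧
      (∃ g ∈ J, g z ≤ (k : ℝ) + 1) ∧ ∀ h ∈ H, 0 ≤ h z := by
    intro z
    rw [D.mem_closure_L_iff hk hT hedge, D.mem_cone_iff]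
    tauto
  obtain ⟨hxC, ⟨f₀, hf₀, hf₀x⟩, g₀, hg₀, hg₀x⟩ := (D.mem_closure_L_iff hk hT hedge x).1 hxX
  have hker : ∀ w : E3, ((∃ f ∈ I, (k : ℝ) < f x) ∨ ∀ f ∈ I, f x = k → f w = 0) →
      ((∃ g ∈ J, g x < (k : ℝ) + 1) ∨ ∀ g ∈ J, g x = (k : ℝ) + 1 → g w = 0) →
      (∀ h ∈ H, h x = 0 → h w = 0) → w = 0 := by
    intro w h1 h2 h3
    by_contra hw
    exact hvert w hw (locallyInvariantAlong_of_forall hX h1 h2 h3)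
  have hx0 : x ≠ 0 := by
    rintro rfl
    rw [map_zero] at hf₀x
    linarith
  have hval : ∀ (l : Module.Dual ℝ E3) (t : ℝ), l (t⁻¹ • x) = l x / t := fun l t => by
    rw [map_smul, smul_eq_mul, div_eq_inv_mul]
  by_cases hF : ∃ f ∈ I, (k : ℝ) < f x
  · by_cases hG : ∃ g ∈ J, g x < (k : ℝ) + 1
    · exact absurd (hker x (Or.inl hF) (Or.inl hG) fun _ _ h => h) hx0
    · push Not at hG
      have hfle : ∀ f ∈ I, f x ≤ (k : ℝ) + 1 := fun f hf =>
        (D.le_of_mem_cone x hxC f hf g₀ hg₀).trans hg₀x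
      have hAP := D.inv_smul_mem hk1 hxC hfle hG
      have hAv : ((k : ℝ) + 1)⁻¹ • x ∈ vertices P := by
        rw [D.mem_vertices_iff hAP, Submodule.eq_bot_iff]
        intro w hw
        rw [mem_activeKer_inv_smul hk1] at hw
        exact hker w (Or.inl hF) (Or.inr hw.2.1) hw.2.2
      refine ⟨((k : ℝ) + 1)⁻¹ • x, ?_, Or.inl (Or.inl (Or.inr ?_))⟩
      · obtain ⟨f, hf, hfx⟩ := hF
        rcases D.vertex_cases hAv with h | h | h
        · exact h
        · have := D.lt_of_mem_near hk hT h hf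
          rw [hval, mul_div_cancel₀ _ hk1.ne'] at this
          linarith
        · have := (D.mem_far_iff.1 h).2 g₀ hg₀
          rw [hval, one_lt_div hk1] at this
          linarith
      · rw [Set.mem_singleton_iff, smul_smul, mul_inv_cancel₀ hk1.ne', one_smul]
  · push Not at hF
    by_cases hG : ∃ g ∈ J, g x < (k : ℝ) + 1
    · have hgle : ∀ g ∈ J, (k : ℝ) ≤ g x := fun g hg =>
        hf₀x.trans (D.le_of_mem_cone x hxC f₀ hf₀ g hg)
      have hAP := D.inv_smul_mem hk0 hxC hF hgle
      have hAv : (k : ℝ)⁻¹ • x ∈ vertices P := by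
        rw [D.mem_vertices_iff hAP, Submodule.eq_bot_iff]
        intro w hw
        rw [mem_activeKer_inv_smul hk0] at hw
        exact hker w (Or.inr hw.1) (Or.inl hG) hw.2.2
      refine ⟨(k : ℝ)⁻¹ • x, ?_, Or.inl (Or.inl (Or.inl ?_))⟩
      · obtain ⟨g, hg, hgx⟩ := hG
        rcases D.vertex_cases hAv with h | h | h
        · exact h
        · have := (D.mem_near_iff.1 h).2 f₀ hf₀
          rw [hval, div_lt_one hk0] at this
          linarith
        · have := D.lt_of_mem_far hT h hg
          rw [hval, mul_div_cancel₀ _ hk0.ne'] at this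
          linarith
      · rw [smul_smul, mul_inv_cancel₀ hk0.ne', one_smul]
    · push Not at hG
      exact D.exists_mem_G_of_crossing hk hT hedge hxC hF
        ⟨f₀, hf₀, le_antisymm (hF f₀ hf₀) hf₀x⟩ hG ⟨g₀, hg₀, le_antisymm hg₀x (hG g₀ hg₀)⟩
        fun w h1 h2 h3 => hker w (Or.inr h1) (Or.inr h2) h3

end RadialData

end PolyhedronCone

theorem mainTheorem8 (P : Set PolyhedronCone.E3)
    (hP : PolyhedronCone.IsConvexPolyhedron P)
    (hnonneg : ∀ x ∈ P, ∀ i : Fin 3, 0 ≤ x i)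
    (hray : ∃ τ ∈ PolyhedronCone.extremalRays P, ∃ A : PolyhedronCone.E3, τ ∩ P = {A})
    (hedge : ∀ A ∈ PolyhedronCone.W P, ∀ B ∈ PolyhedronCone.W P,
      PolyhedronCone.Adjacent P A B →
        segment ℝ A B ⊆ frontier (PolyhedronCone.cone P)) :
    ∃ κ₀ : ℕ, IsLeast (PolyhedronCone.thresholds P) κ₀ ∧
      ∀ k : ℕ, κ₀ ≤ k →
        (⋃ A ∈ PolyhedronCone.W P, PolyhedronCone.G P k A) =
          PolyhedronCone.polyhedralVertices (closure (PolyhedronCone.L P k)) := by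
  obtain ⟨I, J, H, D⟩ := PolyhedronCone.exists_radialData hP
    (PolyhedronCone.zero_notMem_of_ray (PolyhedronCone.convex_of_isConvexPolyhedron hP) hray)
  have hne : (PolyhedronCone.thresholds P).Nonempty := D.exists_mem_thresholds
  refine ⟨sInf (PolyhedronCone.thresholds P), ⟨Nat.sInf_mem hne, fun _ h => Nat.sInf_le h⟩,
    fun k hk => ?_⟩
  have hmin := Nat.sInf_mem hne
  have hT : k ∈ PolyhedronCone.thresholds P := fun j hj => hmin j (hk.trans hj)
  -- The descriptions of `k • P` and of `L P k` by inequalities need a positive factor.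
  have hk0 : 0 < k := Nat.pos_of_ne_zero fun h =>
    D.zero_notMem_thresholds hedge hP.2 (h ▸ hT)
  refine Set.Subset.antisymm ?_ fun x hx => ?_
  · exact Set.iUnion₂_subset fun A hA => D.G_subset_polyhedralVertices hk0 hT hedge hA
  · obtain ⟨A, hA, hxA⟩ := D.exists_mem_G_of_mem_polyhedralVertices hk0 hT hedge hx
    exact Set.mem_iUnion₂.2 ⟨A, hA, hxA⟩
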